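/- Let $q$ be a prime power, $t\ge 2$, $q\ge t$. Let $\Sigma$ be a $q$-order canonical subgeometry of $\mathrm{PG}(t-1,q^t)$, i.e. the set of points $\langle w\rangle_{\mathbb F_{q^t}}$, $w\in W\setminus\{0\}$, of a $t$-dimensional $\mathbb F_q$-subspace $W$ of the underlying vector space that spans it over $\mathbb F_{q^t}$. Let $\Gamma$ be a $(t-3)$-subspace and $\ell_0$ a line with $\Gamma\cap\Sigma=\emptyset=\Gamma\cap\ell_0$, let $p(P)=\langle\Gamma,P\rangle\cap\ell_0$ denote the projection from $\Gamma$ to $\ell_0$, and suppose that $\mathbb L=p(\Sigma)$ is a linear set of pseudoregulus type in $\ell_0$, i.e. projectively equivalent to $\{\langle(\lambda,\lambda^q)\rangle_{\mathbb F_{q^t}}\mid\lambda\in\mathbb F_{q^t}^*\}$. Let $r$ be a $q$-order subline (a $q$-order canonical subgeometry of $\ell_0$) contained in $\mathbb L$. Then there are a divisor $m>1$ of $t$ and an integer $n$ with $1\le n\le m-1$ such that $\Sigma\cap p^{-1}(r)$ is a normal rational curve of order $n$ in some $n$-subspace of $\Sigma$, i.e. it has the form $\{\langle(1,y,\dots,y^n)\rangle\mid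 y\in\mathbb F_q\}\cup\{\langle(0,\dots,0,1)\rangle\}$ in a suitable frame of an $n$-dimensional subspace over $\mathbb F_q$ of $\Sigma$. Moreover, there are homogeneous coordinates $X_1,\dots,X_t$ of $\mathrm{PG}(t-1,q^t)$ and an integer $\nu\ge 0$ with $\gcd(\nu,t)=1$ such that, with $\sigma:x\mapsto x^{q^\nu}$, one has $\Sigma=\{\langle(\lambda,\lambda^\sigma,\dots,\lambda^{\sigma^{t-1}})\rangle_{\mathbb F_{q^t}}\mid\lambda\in\mathbb F_{q^t}^*\}$ and $\Gamma$ has equations $X_{t-1}=X_t=0$. For every such choice of coordinates and of $\nu$, use $(X_{t-1},X_t)$ as homogeneous coordinates on $\ell_0$, let $\mathcal F(r)$ be the regulus of $\mathrm{PG}_q(\mathbb F_{q^t}^2)=\mathrm{PG}(2t-1,q)$ consisting of the $(t-1)$-subspaces $\{\langle(za,zb)\rangle_{\mathbb F_q}\mid z\in\mathbb F_{q^t}^*\}$, $\langle(a,b)\rangle_{\mathbb F_{q^t}}\in r$, and put $$\mathcal S_h=\bigl\{\{\langle(z,kz^{q^h})\rangle_{\mathbb F_q}\mid z\in\mathbb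 F_{q^t}^*\}\ \big|\ k\in\mathbb F_{q^t},\ N_{\mathbb F_{q^t}/\mathbb F_q}(k)=1\bigr\},\qquad h=0,1,\dots,t-1.$$ Then some transversal line of $\mathcal F(r)$ (a line meeting all its elements) is contained in an element of $\mathcal S_h$ for some $h\in\{1,\dots,t-1\}$, and whenever a transversal line of $\mathcal F(r)$ is contained in an element of $\mathcal S_h$, $0\le h\le t-1$, one has $n\equiv h\nu^{-1}\pmod m$, where $\nu^{-1}$ is the inverse of $\nu$ modulo $m$. -/

import Mathlib

open scoped LinearAlgebra.Projectivization

namespace PseudoregulusType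

section Geometry

variable {K : Type*} (L : Type*) {V : Type*} [Field K] [Field L] [Algebra K L]
  [AddCommGroup V] [Module L V] [Module K V]

/-- The set of the `L`-points `⟨w⟩_L`, where `w` is a nonzero vector of the `K`-subspace `W`. -/
def pts (W : Submodule K V) : Set (ℙ L V) :=
  {P | ∃ w ∈ W, ∃ hw : w ≠ 0, P = Projectivization.mk L w hw}

variable {L}

/-- The `K`-subspace `W` defines a canonical subgeometry `pts L W` of the projective space of
the `L`-subspace `U`: the dimensions agree and `W` spans `U` over `L`. -/
def IsCanonicalSubgeometry (U : Submodule L V) (W : Submodule K V) : Prop :=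
  Module.finrank K W = Module.finrank L U ∧ Submodule.span L (W : Set V) = U

/-- The point `Q` of the axis `Λ` is the image of the point `P` under the projection with
centre `Γ`, that is `⟨Γ, P⟩ ∩ Λ = Q`. -/
def ProjectsTo (Γ Λ : Submodule L V) (P Q : ℙ L V) : Prop :=
  (Γ ⊔ P.submodule) ⊓ Λ = Q.submodule

/-- The projection of the point set `S` with centre `Γ` and axis `Λ`. -/
def projection (Γ Λ : Submodule L V) (S : Set (ℙ L V)) : Set (ℙ L V) :=
  {Q | ∃ P ∈ S, ProjectsTo Γ Λ P Q}

/-- The preimage of the point set `r` under the projection with centre `Γ` and axis `Λ`. -/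
def projectionPreimage (Γ Λ : Submodule L V) (r : Set (ℙ L V)) : Set (ℙ L V) :=
  {P | ∃ Q ∈ r, ProjectsTo Γ Λ P Q}

variable (K L) in
/-- The point set `{⟨(x, x^q)⟩ | x ≠ 0}` of the projective line over `L`, with `q = |K|`. -/
def standardPseudoregulus : Set (ℙ L (Fin 2 → L)) :=
  {P | ∃ x : L, x ≠ 0 ∧ P.submodule = Submodule.span L {![x, x ^ Nat.card K]}}

variable (K) in
/-- The point set `S` is a linear set of pseudoregulus type in the line `ℓ`: it is the image of
the standard one under a projectivity onto `ℓ`. -/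
def IsPseudoregulusType (ℓ : Submodule L V) (S : Set (ℙ L V)) : Prop :=
  ∃ (g : (Fin 2 → L) →ₗ[L] V) (hg : Function.Injective g),
    LinearMap.range g = ℓ ∧ Projectivization.map g hg '' standardPseudoregulus K L = S

/-- The point set `C` is a normal rational curve of order `n` in some `n`-subspace `B` of the
subgeometry defined by `W`: in a suitable frame of `B` it consists of the points
`⟨(1, y, …, y^n)⟩`, `y ∈ K`, and of the point `⟨(0, …, 0, 1)⟩`. -/
def IsNormalRationalCurve (W : Submodule K V) (n : ℕ) (C : Set (ℙ L V)) : Prop :=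
  ∃ B : Submodule K V, B ≤ W ∧ ∃ b : Module.Basis (Fin (n + 1)) K B,
    C = {P | (∃ y : K, P.submodule =
                Submodule.span L {∑ i : Fin (n + 1), y ^ (i : ℕ) • (b i : V)}) ∨
              P.submodule = Submodule.span L {(b (Fin.last n) : V)}}

end Geometry

section Coordinates

variable {K L V : Type*} [Field K] [Field L] [Algebra K L]
  [AddCommGroup V] [Module L V] [Module K V] {t : ℕ}

variable (K L) in
/-- With `σ : x ↦ x^(q^ν)`, `q = |K|`, the set of the points
`⟨(x, x^σ, …, x^(σ^(t-1)))⟩`, `x ≠ 0`. -/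
def standardSubgeometry (t ν : ℕ) : Set (ℙ L (Fin t → L)) :=
  {P | ∃ x : L, x ≠ 0 ∧
    P.submodule = Submodule.span L {fun i : Fin t => x ^ Nat.card K ^ (ν * (i : ℕ))}}

/-- The last two coordinates of a vector in the coordinate system `e`. Restricted to a line
disjoint from the subspace where both vanish, they are homogeneous coordinates of that line. -/
def lastTwo (ht : 2 ≤ t) (e : V ≃ₗ[L] (Fin t → L)) : V →ₗ[L] L × L :=
  LinearMap.prod
    (LinearMap.proj (⟨t - 2, by omega⟩ : Fin t) ∘ₗ e.toLinearMap)
    (LinearMap.proj (⟨t - 1, by omega⟩ : Fin t) ∘ₗ e.toLinearMap)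

/-- In the coordinates `e` the subgeometry defined by `W` consists of the points
`⟨(x, x^σ, …, x^(σ^(t-1)))⟩` with `σ : x ↦ x^(q^ν)`, `gcd(ν, t) = 1`, and `Γ` is the subspace
where the last two coordinates vanish. -/
structure IsAdapted (W : Submodule K V) (Γ : Submodule L V) (ht : 2 ≤ t) (ν : ℕ)
    (e : V ≃ₗ[L] (Fin t → L)) : Prop where
  coprime : Nat.Coprime ν t
  subgeometry : Projectivization.map e.toLinearMap e.injective '' pts L W
    = standardSubgeometry K L t ν
  center : Γ = LinearMap.ker (lastTwo ht e)

variable (K L) in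
/-- The set of the vectors of the subspace `S_{h,k}` of `PG_K(L × L)`, i.e. of all
`(z, k z^(q^h))` with `z ∈ L`. -/
def familyMember (h : ℕ) (k : L) : Set (L × L) :=
  {p | ∃ z : L, p = (z, k * z ^ Nat.card K ^ h)}

variable (K) in
/-- Field reduction: the `K`-subspace of `L × L` associated with a point `X`, in the coordinates
given by `c`. -/
def fieldReduction (c : V →ₗ[L] L × L) (X : ℙ L V) : Submodule K (L × L) :=
  (X.submodule.map c).restrictScalars K

/-- The line of `PG_K(L × L)` with underlying `K`-subspace `f` is a transversal of the regulus
of all the field reductions of the points of `r`: it meets every one of them. -/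
def IsTransversal (c : V →ₗ[L] L × L) (r : Set (ℙ L V)) (f : Submodule K (L × L)) : Prop :=
  Module.finrank K f = 2 ∧ ∀ X ∈ r, f ⊓ fieldReduction K c X ≠ ⊥

variable (K) in
/-- Some transversal of the regulus of `r` is contained in an element of the family
`{S_{h,k} | N(k) = 1}`. -/
def HasTransversalInFamily (c : V →ₗ[L] L × L) (r : Set (ℙ L V)) (h : ℕ) : Prop :=
  ∃ (f : Submodule K (L × L)) (k : L), IsTransversal c r f ∧ Algebra.norm K k = 1 ∧
    (f : Set (L × L)) ⊆ familyMember K L h k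

end Coordinates

end PseudoregulusType

open PseudoregulusType

/-! Write `σ = τ^ν` for the generator attached to adapted coordinates, `τ` being the `q`-Frobenius.
There a vector of `W` is labelled by `x ∈ L`, and its last two coordinates are a fixed multiple of
`(x, σ x)`. Hence every nonzero vector of `R` has two coordinates of equal norm. If `R` is spanned
by two vectors whose coordinates have ratios `a` and `b`, this gives `N(a + y) = N(b + y)` for all
`y ∈ K`. Two monic polynomials of degree `t ≤ q` then agree at `q` points, so `b = g a` for some
automorphism `g` (`exists_algEquiv_of_norm_add_eq`). Thus `R` consists of the vectors `(p z, p' g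
z)` with `z ∈ ⟨1, a⟩`: a twisted pair.

Let `m` be the period of `a` under `τ`, and choose `0 < n < m` with `σ^n a = g a`. A point with
label `x` projects into `r` iff `σ x / x = (p'/p) σ^n z / z` for some such `z`. Since `p'/p = σ d /
d` and `σ^n z / z` telescopes, the solutions are the `K`-multiples of `x = d ∏_{l<n} σ^l z`. For `z
= 1 + y a` this is a polynomial in `y` whose coefficients are `d` times the elementary symmetric
functions of `a, …, σ^(n-1) a`. They are independent over `K` (`linearIndependent_coeff_conjProd`),
so the points form a normal rational curve.

Adapted coordinates exist because the projected subgeometry is the graph of a norm-preserving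
`K`-linear map. Such a map is a constant times an automorphism
(`exists_eq_mul_algEquiv_of_norm_eq`), and a count of quotients shows that the automorphism is a
generator.

A transversal inside a member of `S_h` is the same as a description of `R` as a twisted pair with `g
= τ^h`. Different descriptions have `a` related by a fractional linear map over `K`, so `h` is
determined modulo `m`. For `t ≥ 3`, independence of automorphisms shows that two adapted systems
differ by a diagonal or antidiagonal matrix, with `σ` kept or inverted (`generators_of_relation`);
both preserve `n`. For `t = 2` all the numbers are forced. -/

namespace PseudoregulusType

/-! ### Norms, conjugates and the Galois group over a finite field -/

section Galois

open Polynomial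

variable (K L : Type*) [Field K] [Finite K] [Field L] [Algebra K L] [FiniteDimensional K L]

/-- The Frobenius automorphism `x ↦ x^q`, `q = |K|`, of `L` over `K`. -/
noncomputable def relFrobenius : L ≃ₐ[K] L :=
  letI := Fintype.ofFinite K
  FiniteField.frobeniusAlgEquivOfAlgebraic K L

theorem relFrobenius_pow_apply (n : ℕ) (x : L) :
    (relFrobenius K L ^ n) x = x ^ Nat.card K ^ n := by
  let := Fintype.ofFinite K
  rw [relFrobenius, AlgEquiv.coe_pow, FiniteField.coe_frobeniusAlgEquivOfAlgebraic_iterate,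
    Fintype.card_eq_nat_card]

theorem orderOf_relFrobenius : orderOf (relFrobenius K L) = Module.finrank K L := by
  let := Fintype.ofFinite K
  have : Finite L := Module.finite_of_finite K
  exact FiniteField.orderOf_frobeniusAlgEquivOfAlgebraic K L

variable {K L}

theorem exists_relFrobenius_pow_eq (g : L ≃ₐ[K] L) :
    ∃ n < Module.finrank K L, relFrobenius K L ^ n = g := by
  let := Fintype.ofFinite K
  have : Finite L := Module.finite_of_finite K
  obtain ⟨n, hn⟩ := (FiniteField.bijective_frobeniusAlgEquivOfAlgebraic_pow K L).2 g
  exact ⟨n, n.2, hn⟩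

theorem algEquiv_mul_comm (g h : L ≃ₐ[K] L) : g * h = h * g := by
  obtain ⟨n, -, rfl⟩ := exists_relFrobenius_pow_eq g
  obtain ⟨m, -, rfl⟩ := exists_relFrobenius_pow_eq h
  rw [← pow_add, ← pow_add, add_comm]

theorem algEquiv_apply_comm (g h : L ≃ₐ[K] L) (x : L) : g (h x) = h (g x) := by
  rw [← AlgEquiv.mul_apply, algEquiv_mul_comm, AlgEquiv.mul_apply]

theorem exists_eq_algebraMap_of_relFrobenius {x : L} (hx : relFrobenius K L x = x) :
    ∃ y : K, algebraMap K L y = x := by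
  have : Finite L := Module.finite_of_finite K
  refine (IsGalois.mem_range_algebraMap_iff_fixed x).2 fun g => ?_
  obtain ⟨n, -, rfl⟩ := exists_relFrobenius_pow_eq g
  induction n with
  | zero => rfl
  | succ n ih => rw [pow_succ, AlgEquiv.mul_apply, hx, ih]

theorem exists_eq_algebraMap_of_apply_eq {g : L ≃ₐ[K] L} (hg : orderOf g = Module.finrank K L)
    {x : L} (hx : g x = x) : ∃ y : K, algebraMap K L y = x := by
  have : Finite L := Module.finite_of_finite K
  apply exists_eq_algebraMap_of_relFrobenius
  have hz : Subgroup.zpowers g = ⊤ := by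
    apply Subgroup.eq_top_of_card_eq
    rw [Nat.card_zpowers, hg, IsGalois.card_aut_eq_finrank]
  have hm : relFrobenius K L ∈ Subgroup.zpowers g := hz ▸ Subgroup.mem_top _
  have hs : g ∈ MulAction.stabilizer (L ≃ₐ[K] L) x := hx
  exact (Subgroup.zpowers_le.2 hs) hm

/-- Elements whose translates by scalars have equal norms are conjugate, if the degree of the
extension is at most the number of the scalars. -/
theorem exists_algEquiv_of_norm_add_eq (hq : Module.finrank K L ≤ Nat.card K) {a b : L}
    (h : ∀ y : K, Algebra.norm K (a + algebraMap K L y) = Algebra.norm K (b + algebraMap K L y)) :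
    ∃ g : L ≃ₐ[K] L, b = g a := by
  classical
  let := Fintype.ofFinite K
  have : Finite L := Module.finite_of_finite K
  let F : L → L[X] := fun a => ∏ g : L ≃ₐ[K] L, (X + C (g a))
  have hmonic : ∀ a, (F a).Monic := fun a =>
    monic_prod_of_monic _ _ fun g _ => monic_X_add_C _
  have hdeg : ∀ a, (F a).degree = Module.finrank K L := by
    intro a
    simp only [F, degree_prod, degree_X_add_C]
    simp [← IsGalois.card_aut_eq_finrank K L, Nat.card_eq_fintype_card]
  have heval : ∀ a (y : K), (F a).eval (algebraMap K L y) =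
      algebraMap K L (Algebra.norm K (a + algebraMap K L y)) := by
    intro a y
    rw [Algebra.norm_eq_prod_automorphisms]
    simp [F, eval_prod, add_comm]
  -- The difference has degree less than `t` but vanishes at the `q ≥ t` elements of `K`.
  have hF : F a = F b := by
    apply eq_of_degree_sub_lt_of_eval_finset_eq
      (Finset.univ.map ⟨algebraMap K L, (algebraMap K L).injective⟩)
    · have : (F a - F b).degree < (F a).degree :=
        degree_sub_lt_left (by rw [hdeg, hdeg]) (hmonic a).ne_zero
          (by rw [(hmonic a).leadingCoeff, (hmonic b).leadingCoeff])
      refine this.trans_le ?_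
      rw [hdeg, Finset.card_map, Finset.card_univ, Fintype.card_eq_nat_card]
      exact_mod_cast hq
    · intro x hx
      obtain ⟨y, -, rfl⟩ := Finset.mem_map.1 hx
      simp only [Function.Embedding.coeFn_mk]
      rw [heval, heval, h]
  have h0 : (F a).eval (-b) = 0 := by
    rw [hF]
    simp only [F, eval_prod]
    exact Finset.prod_eq_zero (Finset.mem_univ 1) (by simp)
  simp only [F, eval_prod, Finset.prod_eq_zero_iff] at h0
  obtain ⟨g, -, hg⟩ := h0
  refine ⟨g, ?_⟩
  simp only [eval_add, eval_X, eval_C] at hg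
  linear_combination -hg

/-- A vector space over a finite field with `q` elements is not a union of at most `q` proper
subspaces. -/
theorem exists_eq_top_of_forall_exists_mem {ι E : Type*} [Fintype ι] [AddCommGroup E] [Module K E]
    [FiniteDimensional K E] (hι : Fintype.card ι ≤ Nat.card K) (p : ι → Submodule K E)
    (hp : ∀ x, ∃ i, x ∈ p i) : ∃ i, p i = ⊤ := by
  classical
  have : Finite E := Module.finite_of_finite K
  let := Fintype.ofFinite E
  let := Fintype.ofFinite K
  by_contra! hne
  obtain ⟨i₀, -⟩ := hp 0
  have hEpos : 0 < Module.finrank K E := by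
    have := Submodule.finrank_lt (hne i₀)
    omega
  set q := Nat.card K with hqdef
  have hq1 : 1 < q := Finite.one_lt_card
  obtain ⟨d, hd⟩ : ∃ d, Module.finrank K E = d + 1 := ⟨_, (Nat.succ_pred_eq_of_pos hEpos).symm⟩
  have hcard : ∀ i, ((Finset.univ.filter (· ∈ p i)).erase 0).card ≤ q ^ d - 1 := by
    intro i
    rw [Finset.card_erase_of_mem (by simp)]
    apply Nat.sub_le_sub_right
    have h1 : (Finset.univ.filter (· ∈ p i)).card = Nat.card (p i) := by
      rw [← Fintype.card_subtype, Fintype.card_eq_nat_card]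
    rw [h1, Module.natCard_eq_pow_finrank (K := K)]
    apply Nat.pow_le_pow_right (by omega)
    have := Submodule.finrank_lt (hne i)
    omega
  have hcov : (Finset.univ.erase (0 : E)) ⊆
      Finset.univ.biUnion fun i => (Finset.univ.filter (· ∈ p i)).erase 0 := by
    intro x hx
    obtain ⟨i, hi⟩ := hp x
    simp only [Finset.mem_biUnion]
    exact ⟨i, Finset.mem_univ _, by simpa using ⟨(Finset.mem_erase.1 hx).1, hi⟩⟩
  have h1 := (Finset.card_le_card hcov).trans (Finset.card_biUnion_le_card_mul _ _ _
    fun i _ => hcard i)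
  rw [Finset.card_erase_of_mem (Finset.mem_univ _), Finset.card_univ, Finset.card_univ,
    Fintype.card_eq_nat_card, Module.natCard_eq_pow_finrank (K := K), hd, ← hqdef] at h1
  have h2 := h1.trans (Nat.mul_le_mul_right _ hι)
  have h3 : 1 ≤ q ^ d := Nat.one_le_pow _ _ (by omega)
  -- So `q` proper subspaces hold at most `q^(d+1) - q` nonzero vectors, fewer than the `q^(d+1) -
  -- 1` available.
  have h4 : q * (q ^ d - 1) = q ^ (d + 1) - q := by rw [Nat.mul_sub, pow_succ']; simp
  have h5 : q ≤ q ^ (d + 1) := Nat.le_self_pow (by omega) _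
  omega

/-- A linear map which preserves the norm is an automorphism followed by a multiplication. -/
theorem exists_eq_mul_algEquiv_of_norm_eq (hq : Module.finrank K L ≤ Nat.card K) (f : L →ₗ[K] L)
    (hf : ∀ x, Algebra.norm K (f x) = Algebra.norm K x) :
    ∃ g : L ≃ₐ[K] L, ∀ x, f x = f 1 * g x := by
  have : Finite L := Module.finite_of_finite K
  have hn1 : Algebra.norm K (f 1) = 1 := by rw [hf, map_one]
  have h1 : f 1 ≠ 0 := by
    intro h
    rw [h, Algebra.norm_zero] at hn1
    exact zero_ne_one hn1
  -- Each `x` has its own `g`; since the `t ≤ q` kernels cover `L`, one `g` serves all `x`.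
  have key : ∀ x, ∃ g : L ≃ₐ[K] L, x ∈ LinearMap.ker (f - (f 1) • g.toLinearMap) := by
    intro x
    obtain ⟨g, hg⟩ := exists_algEquiv_of_norm_add_eq hq (a := x) (b := f x / f 1) fun y => by
      have h2 : f (x + algebraMap K L y) = f 1 * (f x / f 1 + algebraMap K L y) := by
        rw [map_add, Algebra.algebraMap_eq_smul_one y, map_smul, mul_add, mul_div_cancel₀ _ h1]
        simp
      rw [← hf, h2, map_mul, hn1, one_mul]
    refine ⟨g, ?_⟩
    rw [LinearMap.mem_ker, LinearMap.sub_apply, LinearMap.smul_apply, AlgEquiv.toLinearMap_apply,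
      ← hg, smul_eq_mul, mul_div_cancel₀ _ h1, sub_self]
  obtain ⟨g, hg⟩ := exists_eq_top_of_forall_exists_mem
    (by rwa [Fintype.card_eq_nat_card, IsGalois.card_aut_eq_finrank]) _ key
  refine ⟨g, fun x => ?_⟩
  have : x ∈ LinearMap.ker (f - (f 1) • g.toLinearMap) := hg ▸ Submodule.mem_top
  rw [LinearMap.mem_ker, LinearMap.sub_apply, sub_eq_zero] at this
  simpa using this

/-- The vectors of the conjugates of linearly independent elements are linearly independent. -/
theorem linearIndependent_conjugates {ι κ : Type*} [Fintype ι] (s : κ → L ≃ₐ[K] L)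
    (hs : Function.Surjective s) {x : ι → L} (hx : LinearIndependent K x) :
    LinearIndependent L fun (i : ι) (j : κ) => s j (x i) := by
  have : Finite L := Module.finite_of_finite K
  rw [Fintype.linearIndependent_iff] at hx ⊢
  intro c hc
  have h1 : ∀ g : L ≃ₐ[K] L, ∑ i, g (c i) * x i = 0 := by
    intro g
    obtain ⟨j, hj⟩ := hs g⁻¹
    have := congrArg g (congrFun hc j)
    simpa [hj, AlgEquiv.aut_inv] using this
  intro i
  -- Multiplying `h1` by `g l` and summing over `g` turns the coefficients into traces, which lie in
  -- `K`.
  have h2 : ∀ l : L, Algebra.trace K L (l * c i) = 0 := by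
    intro l
    refine hx (fun i => Algebra.trace K L (l * c i)) ?_ i
    simp only [Algebra.smul_def, trace_eq_sum_automorphisms, map_mul, Finset.sum_mul]
    rw [Finset.sum_comm]
    refine Finset.sum_eq_zero fun g _ => ?_
    simp only [mul_assoc]
    rw [← Finset.mul_sum, h1, mul_zero]
  refine (traceForm_nondegenerate K L).1 (c i) fun l => ?_
  rw [Algebra.traceForm_apply, mul_comm, h2]

theorem pow_surjective_of_orderOf {g : L ≃ₐ[K] L} {t : ℕ} (hg : orderOf g = t)
    (hL : Module.finrank K L = t) : Function.Surjective fun i : Fin t => g ^ (i : ℕ) := by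
  have : Finite L := Module.finite_of_finite K
  have hinj : Function.Injective fun i : Fin t => g ^ (i : ℕ) := by
    intro i j hij
    exact Fin.ext (pow_injOn_Iio_orderOf (by simp [hg]) (by simp [hg]) hij)
  refine ((Nat.bijective_iff_injective_and_card _).2 ⟨hinj, ?_⟩).2
  rw [IsGalois.card_aut_eq_finrank, hL, Nat.card_eq_fintype_card, Fintype.card_fin]

end Galois

/-! ### Products over consecutive conjugates; relations between automorphisms -/

section Galois

open Polynomial

variable {K L : Type*} [Field K] [Field L] [Algebra K L]

/-- The product of the linear polynomials `1 + α X` over the conjugates `α` of `a` under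
`g^i, …, g^(i+k-1)`. -/
noncomputable def conjProd (g : L ≃ₐ[K] L) (a : L) (i k : ℕ) : L[X] :=
  ∏ l ∈ Finset.range k, (1 + C ((g ^ (i + l)) a) * X)

theorem map_conjProd (g : L ≃ₐ[K] L) (a : L) (i k : ℕ) :
    conjProd g a i k = (conjProd g a 0 k).map ((g ^ i : L ≃ₐ[K] L) : L →+* L) := by
  simp [conjProd, Polynomial.map_prod, pow_add, AlgEquiv.mul_apply]

/-- Two consecutive windows of conjugates share all factors but the first of one and the last of the
other. -/
theorem conjProd_sub (g : L ≃ₐ[K] L) (a : L) (i k : ℕ) :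
    conjProd g a i (k + 1) - conjProd g a (i + 1) (k + 1) =
      C ((g ^ i) a - (g ^ (i + (k + 1))) a) * (X * conjProd g a (i + 1) k) := by
  have h1 : conjProd g a i (k + 1) = conjProd g a (i + 1) k * (1 + C ((g ^ i) a) * X) := by
    rw [conjProd, Finset.prod_range_succ', add_zero]
    congr 1
    refine Finset.prod_congr rfl fun l _ => ?_
    rw [show i + (l + 1) = i + 1 + l by ring]
  have h2 : conjProd g a (i + 1) (k + 1) =
      conjProd g a (i + 1) k * (1 + C ((g ^ (i + (k + 1))) a) * X) := by
    rw [conjProd, Finset.prod_range_succ, show i + 1 + k = i + (k + 1) by ring]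
    rfl
  rw [h1, h2, map_sub]
  ring

theorem coeff_zero_conjProd (g : L ≃ₐ[K] L) (a : L) (i k : ℕ) :
    (conjProd g a i k).coeff 0 = 1 := by
  simp [conjProd, coeff_zero_prod]

theorem natDegree_conjProd_le (g : L ≃ₐ[K] L) (a : L) (i k : ℕ) :
    (conjProd g a i k).natDegree ≤ k := by
  refine (natDegree_prod_le _ _).trans ((Finset.sum_le_card_nsmul _ _ 1 fun l _ => ?_).trans
    (by simp))
  compute_degree

theorem coeff_conjProd_self (g : L ≃ₐ[K] L) (a : L) (n : ℕ) :
    (conjProd g a 0 n).coeff n = ∏ l ∈ Finset.range n, (g ^ l) a := by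
  have := coeff_prod_of_natDegree_le (Finset.range n)
    (fun l => (1 + C ((g ^ (0 + l)) a) * X : L[X])) 1 fun l _ => by compute_degree
  simpa [conjProd, coeff_one] using this

theorem prod_one_add_eq_sum (g : L ≃ₐ[K] L) (a : L) (n : ℕ) (y : K) :
    ∏ l ∈ Finset.range n, (g ^ l) (1 + y • a) =
      ∑ j : Fin (n + 1), y ^ (j : ℕ) • (conjProd g a 0 n).coeff j := by
  have h1 : ∏ l ∈ Finset.range n, (g ^ l) (1 + y • a) =
      (conjProd g a 0 n).eval (algebraMap K L y) := by
    rw [conjProd, eval_prod]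
    refine Finset.prod_congr rfl fun l _ => ?_
    rw [map_add, map_one, map_smul, Algebra.smul_def, mul_comm, eval_add, eval_one, eval_mul,
      eval_C, eval_X, zero_add]
  rw [h1, eval_eq_sum_range' (Nat.lt_succ_of_le (natDegree_conjProd_le g a 0 n)),
    Finset.sum_range]
  refine Finset.sum_congr rfl fun j _ => ?_
  rw [Algebra.smul_def, map_pow, mul_comm]

/-- A relation over `K` is a functional `Φ` on polynomials that commutes with the Galois action, so
it kills every shifted window. Differences of adjacent windows then show that it kills `X^d` times
every window of length `n - d` starting at `d` or later. These products have lowest term `X^d`, so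
the system is triangular and the `c j` vanish from `j = n` downwards. -/
theorem linearIndependent_coeff_conjProd (g : L ≃ₐ[K] L) (a : L) (n : ℕ)
    (ha : ∀ k, 0 < k → k ≤ n → (g ^ k) a ≠ a) :
    LinearIndependent K fun j : Fin (n + 1) => (conjProd g a 0 n).coeff j := by
  rw [Fintype.linearIndependent_iff]
  intro c hc
  let Φ : L[X] →ₗ[L] L := ∑ j : Fin (n + 1), algebraMap K L (c j) • lcoeff L (j : ℕ)
  have hΦ : ∀ p : L[X], Φ p = ∑ j : Fin (n + 1), algebraMap K L (c j) * p.coeff j := by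
    intro p
    simp [Φ, Algebra.smul_def]
  have hstart : ∀ i, Φ (conjProd g a i n) = 0 := by
    intro i
    have h := congrArg (g ^ i : L ≃ₐ[K] L) hc
    rw [hΦ, map_conjProd]
    simp only [Algebra.smul_def, map_sum, map_mul, AlgEquiv.commutes, map_zero, coeff_map] at h ⊢
    exact h
  have hshift : ∀ d ≤ n, ∀ i, d ≤ i → Φ (X ^ d * conjProd g a i (n - d)) = 0 := by
    intro d
    induction d with
    | zero => intro _ i _; simpa using hstart i
    | succ d ih =>
      intro hd i hi
      obtain ⟨i, rfl⟩ : ∃ i', i = i' + 1 := ⟨i - 1, by omega⟩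
      have h1 := ih (by omega) i (by omega)
      have h2 := ih (by omega) (i + 1) (by omega)
      rw [show n - d = (n - (d + 1)) + 1 by omega] at h1 h2
      have h3 : Φ (X ^ d * (conjProd g a i (n - (d + 1) + 1)
          - conjProd g a (i + 1) (n - (d + 1) + 1))) = 0 := by
        rw [mul_sub, map_sub, h1, h2, sub_zero]
      rw [conjProd_sub, mul_left_comm, ← mul_assoc (X ^ d), ← pow_succ, ← smul_eq_C_mul,
        map_smul, smul_eq_mul, mul_eq_zero, sub_eq_zero] at h3
      -- The scalar in front is the difference of two conjugates of `a` that are `n - d` steps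
      -- apart, hence nonzero by `ha`.
      refine h3.resolve_left fun h4 => ha (n - (d + 1) + 1) (by omega) (by omega) ?_
      rw [pow_add, AlgEquiv.mul_apply] at h4
      exact ((g ^ i).injective h4).symm
  have hfin : ∀ d ≤ n, ∀ j : Fin (n + 1), (j : ℕ) = n - d → c j = 0 := by
    intro d
    induction d using Nat.strong_induction_on with
    | _ d ih =>
      intro hd j hj
      have h1 := hshift j (by omega) j le_rfl
      rw [hΦ, Finset.sum_eq_single j] at h1
      · rw [coeff_X_pow_mul', if_pos le_rfl, Nat.sub_self, coeff_zero_conjProd, mul_one] at h1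
        exact (algebraMap K L).injective (by simpa using h1)
      · intro j' _ hj'
        rw [coeff_X_pow_mul']
        split_ifs with hlt
        · have : (j : ℕ) ≠ j' := fun h => hj' (Fin.ext h.symm)
          rw [ih (n - j') (by omega) (by omega) j' (by omega), map_zero, zero_mul]
        · rw [mul_zero]
      · simp
  exact fun j => hfin (n - j) (by omega) j (by omega)

/-- Telescoping: applying `g` shifts the window by one. This is the multiplicative form of `g Π / Π
= g^n y / y`. -/
theorem map_prod_conj_mul (g : L ≃ₐ[K] L) (n : ℕ) (y : L) :
    g (∏ l ∈ Finset.range n, (g ^ l) y) * y = (∏ l ∈ Finset.range n, (g ^ l) y) * (g ^ n) y := by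
  have h1 := Finset.prod_range_succ' (fun l => (g ^ l) y) n
  rw [Finset.prod_range_succ] at h1
  rw [h1, map_prod]
  simp [pow_succ', AlgEquiv.mul_apply]

theorem quotient_of_eq_algebraMap_mul {σ : L ≃ₐ[K] L} {d z : L} {n : ℕ} (k : K) :
    σ d * (σ ^ n) z * (algebraMap K L k * (d * ∏ l ∈ Finset.range n, (σ ^ l) z)) =
      d * z * σ (algebraMap K L k * (d * ∏ l ∈ Finset.range n, (σ ^ l) z)) := by
  have hpi := map_prod_conj_mul σ n z
  rw [map_mul, map_mul, AlgEquiv.commutes]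
  linear_combination (-(d * σ d * algebraMap K L k)) * hpi

theorem pow_apply_eq_pow_apply_iff (g : L ≃ₐ[K] L) (a : L) (i j : ℕ) :
    (g ^ i) a = (g ^ j) a ↔ (i : ZMod (MulAction.period g a)) = j := by
  have h1 : (g ^ i) a = (g ^ j) a ↔ g ^ (-(i : ℤ) + j) • a = a := by
    rw [zpow_add, zpow_neg, zpow_natCast, zpow_natCast, mul_smul, inv_smul_eq_iff, eq_comm]
    rfl
  rw [h1, MulAction.zpow_smul_eq_iff_period_dvd]
  have := ZMod.intCast_eq_intCast_iff_dvd_sub (i : ℤ) (j : ℤ) (MulAction.period g a)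
  rw [neg_add_eq_sub, ← this]
  simp

/-- In a degree at least three, a nontrivial relation `γ + δ s = A s' + B s' s` between
generators `s`, `s'` of the Galois group forces `s' = s` or `s' = s⁻¹`. -/
theorem generators_of_relation {s s' : L ≃ₐ[K] L} (ht : 3 ≤ Module.finrank K L)
    (hs : orderOf s = Module.finrank K L) (hs' : orderOf s' = Module.finrank K L)
    {γ δ A B : L} (hAB : A ≠ 0 ∨ B ≠ 0)
    (h : ∀ x, γ * x + δ * s x = A * s' x + B * s' (s x)) :
    (s' = s ∧ γ = 0 ∧ B = 0) ∨ (s' * s = 1 ∧ A = 0 ∧ δ = 0) := by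
  classical
  have hli : LinearIndependent L fun g : L ≃ₐ[K] L => (g : L → L) :=
    (linearIndependent_monoidHom L L).comp (fun g : L ≃ₐ[K] L => (g : L →* L))
      fun g g' hg => AlgEquiv.ext fun x => DFunLike.congr_fun hg x
  -- Dedekind independence compares coefficients at `1`, `s`, `s'`, `s' * s`. A nonzero `A`-term can
  -- only meet `s`, and a nonzero `B`-term only `1`; degree at least three gives `s * s ≠ 1`.
  have hf := linearIndependent_iff.1 hli (Finsupp.single 1 γ + Finsupp.single s δ
    - Finsupp.single s' A - Finsupp.single (s' * s) B) (by
      ext x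
      simp only [map_add, map_sub, Finsupp.linearCombination_single, Pi.add_apply, Pi.sub_apply,
        Pi.smul_apply, smul_eq_mul, AlgEquiv.one_apply, AlgEquiv.mul_apply, Pi.zero_apply]
      linear_combination h x)
  have hs1 : s ≠ 1 := by rintro rfl; rw [orderOf_one] at hs; omega
  have hs1' : s' ≠ 1 := by rintro rfl; rw [orderOf_one] at hs'; omega
  have hs2 : s * s ≠ 1 := by
    intro h2
    have := orderOf_le_of_pow_eq_one (x := s) two_pos (by rw [pow_two, h2])
    omega
  have hs2' : s * s ≠ s := by simpa using hs1
  have e1 := DFunLike.congr_fun hf 1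
  have e2 := DFunLike.congr_fun hf s
  have e3 := DFunLike.congr_fun hf s'
  have e4 := DFunLike.congr_fun hf (s' * s)
  simp only [Finsupp.sub_apply, Finsupp.add_apply, Finsupp.single_apply, Finsupp.zero_apply]
    at e1 e2 e3 e4
  have hm : s' * s ≠ s := by simpa using hs1'
  have hm' : s' * s ≠ s' := by simpa using hs1
  by_cases hA : A = 0
  · subst hA
    have hB : B ≠ 0 := by simpa using hAB
    by_cases h1 : s' * s = 1
    · refine Or.inr ⟨h1, rfl, ?_⟩
      simpa [h1, hs1, hs1.symm] using e2
    · exact absurd (by simpa [h1, hm, Ne.symm h1, hm.symm] using e4) hB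
  · by_cases h1 : s' = s
    · subst h1
      refine Or.inl ⟨rfl, ?_, ?_⟩
      · simpa [hs1, hs2] using e1
      · simpa [hs2.symm, hs2'.symm] using e4
    · exact absurd (by simpa [h1, Ne.symm h1, hs1', hs1'.symm, hm'] using e3) hA

end Galois

/-! ### Recognizing a generator of the Galois group -/

section Generator

variable {K L : Type*} [Field K] [Finite K] [Field L] [Algebra K L] [FiniteDimensional K L]

/-- The homomorphism `x ↦ s x / x` on `Lˣ` has the units of the fixed field of `s` as kernel.
Division by `k` embeds the image for Frobenius into the image for `g`, so the kernel for `g` is no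
larger than `Kˣ`. Thus `g` has fixed field `K`. -/
theorem orderOf_eq_finrank_of_quotients (g : L ≃ₐ[K] L) (k : L)
    (h : ∀ x : L, x ≠ 0 → ∃ y : L, y ≠ 0 ∧ relFrobenius K L x / x = k * (g y / y)) :
    orderOf g = Module.finrank K L := by
  have : Finite L := Module.finite_of_finite K
  let quot : (L ≃ₐ[K] L) → Lˣ →* Lˣ := fun s => Units.map (s : L →* L) / MonoidHom.id Lˣ
  have hker : ∀ s x, x ∈ (quot s).ker ↔ s (x : L) = x := by
    intro s x
    simp only [quot, MonoidHom.mem_ker, MonoidHom.div_apply, div_eq_one, Units.ext_iff]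
    rfl
  have hval : ∀ s x, ((quot s x : Lˣ) : L) = s x / x := by
    intro s x
    simp [quot]
  have hcard : ∀ s, Nat.card (quot s).ker * Nat.card (quot s).range = Nat.card Lˣ := by
    intro s
    rw [← Subgroup.index_ker, Subgroup.card_mul_index]
  have hle : (quot (relFrobenius K L)).ker ≤ (quot g).ker := by
    intro x hx
    rw [hker] at hx ⊢
    obtain ⟨y, hy⟩ := exists_eq_algebraMap_of_relFrobenius hx
    rw [← hy, AlgEquiv.commutes]
  have hrange : Nat.card (quot (relFrobenius K L)).range ≤ Nat.card (quot g).range := by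
    have hmaps : ∀ z : (quot (relFrobenius K L)).range, ∃ w : (quot g).range,
        ((z : Lˣ) : L) = k * ((w : Lˣ) : L) := by
      rintro ⟨_, x, rfl⟩
      obtain ⟨y, hy, hxy⟩ := h x x.ne_zero
      refine ⟨⟨quot g (Units.mk0 y hy), ⟨_, rfl⟩⟩, ?_⟩
      simp only [hval, hxy, Units.val_mk0]
    choose F hF using hmaps
    refine Nat.card_le_card_of_injective F fun z z' hz => ?_
    apply Subtype.ext
    apply Units.ext
    rw [hF, hF, hz]
  have hkercard : Nat.card (quot g).ker ≤ Nat.card (quot (relFrobenius K L)).ker := by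
    have h1 := hcard (relFrobenius K L)
    have h2 := hcard g
    have hpos : 0 < Nat.card (quot g).range := Nat.card_pos
    by_contra! hlt
    have := Nat.mul_lt_mul_of_lt_of_le hlt hrange hpos
    omega
  have heq := Subgroup.eq_of_le_of_card_ge hle hkercard
  have hfix : IntermediateField.fixedField (Subgroup.zpowers g) = ⊥ := by
    rw [eq_bot_iff]
    intro x hx
    rcases eq_or_ne x 0 with rfl | hx0
    · exact zero_mem _
    have h1 : Units.mk0 x hx0 ∈ (quot g).ker := by
      rw [hker]
      exact hx ⟨g, Subgroup.mem_zpowers g⟩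
    rw [← heq, hker] at h1
    exact IntermediateField.mem_bot.2 (exists_eq_algebraMap_of_relFrobenius h1)
  have htop : Subgroup.zpowers g = ⊤ := by
    rw [← IntermediateField.fixingSubgroup_fixedField (Subgroup.zpowers g), hfix,
      IntermediateField.fixingSubgroup_bot]
  rw [← Nat.card_zpowers, htop, Subgroup.card_top, IsGalois.card_aut_eq_finrank]

end Generator

/-! ### Projections and subgeometries in coordinates -/

section Projection

variable {K L V : Type*} [Field K] [Field L] [AddCommGroup V] [Module L V] [Module K V]

/-- A map `c` with kernel `Γ` forgets exactly the centre, so a point and its image have proportional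
values under `c`. -/
theorem projectsTo_mk_iff {Γ ℓ : Submodule L V} (hd : Disjoint Γ ℓ) {c : V →ₗ[L] L × L}
    (hc : LinearMap.ker c = Γ) {w u : V} (hw : w ≠ 0) (hu : u ≠ 0) :
    ProjectsTo Γ ℓ (Projectivization.mk L w hw) (Projectivization.mk L u hu) ↔
      u ∈ ℓ ∧ ∃ l : L, l ≠ 0 ∧ c u = l • c w := by
  rw [ProjectsTo, Projectivization.submodule_mk, Projectivization.submodule_mk]
  constructor
  · intro h
    have hmem : u ∈ (Γ ⊔ Submodule.span L {w}) ⊓ ℓ := h ▸ Submodule.mem_span_singleton_self u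
    obtain ⟨h1, h2⟩ := hmem
    obtain ⟨v, hv, v', hv', rfl⟩ := Submodule.mem_sup.1 h1
    obtain ⟨l, rfl⟩ := Submodule.mem_span_singleton.1 hv'
    refine ⟨h2, l, ?_, ?_⟩
    · rintro rfl
      apply hu
      rw [zero_smul, add_zero] at h2 ⊢
      exact Submodule.disjoint_def.1 hd v hv h2
    · rw [map_add, map_smul, LinearMap.mem_ker.1 (hc ▸ hv), zero_add]
  · rintro ⟨h2, l, hl, h⟩
    apply le_antisymm
    · rintro _ ⟨h1, h3⟩
      obtain ⟨v, hv, v', hv', rfl⟩ := Submodule.mem_sup.1 h1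
      obtain ⟨m, rfl⟩ := Submodule.mem_span_singleton.1 hv'
      refine Submodule.mem_span_singleton.2 ⟨m * l⁻¹, ?_⟩
      rw [← sub_eq_zero]
      refine Submodule.disjoint_def.1 hd _ ?_ (ℓ.sub_mem (ℓ.smul_mem _ h2) h3)
      have hcv : c v = 0 := by rwa [← LinearMap.mem_ker, hc]
      rw [← hc, LinearMap.mem_ker, map_sub, map_add, map_smul, map_smul, hcv,
        h, smul_smul, mul_assoc, inv_mul_cancel₀ hl, mul_one,
        zero_add, sub_self]
    · rw [Submodule.span_singleton_le_iff_mem]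
      refine ⟨?_, h2⟩
      have h4 : u - l • w ∈ Γ := by
        rw [← hc, LinearMap.mem_ker, map_sub, map_smul, h, sub_self]
      rw [← sub_add_cancel u (l • w)]
      exact Submodule.add_mem_sup h4 (Submodule.smul_mem _ _ (Submodule.mem_span_singleton_self w))

theorem mk_mem_projection_iff {Γ ℓ : Submodule L V} (hd : Disjoint Γ ℓ) {c : V →ₗ[L] L × L}
    (hc : LinearMap.ker c = Γ) {W : Submodule K V} {u : V} (hu : u ≠ 0) :
    Projectivization.mk L u hu ∈ projection Γ ℓ (pts L W) ↔
      u ∈ ℓ ∧ ∃ w ∈ W, w ≠ 0 ∧ ∃ l : L, l ≠ 0 ∧ c u = l • c w := by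
  constructor
  · rintro ⟨_, ⟨w, hw, hw0, rfl⟩, h⟩
    obtain ⟨h1, h2⟩ := (projectsTo_mk_iff hd hc hw0 hu).1 h
    exact ⟨h1, w, hw, hw0, h2⟩
  · rintro ⟨h1, w, hw, hw0, h2⟩
    exact ⟨_, ⟨w, hw, hw0, rfl⟩, (projectsTo_mk_iff hd hc hw0 hu).2 ⟨h1, h2⟩⟩

theorem mk_mem_projectionPreimage_iff {Γ ℓ : Submodule L V} (hd : Disjoint Γ ℓ)
    {c : V →ₗ[L] L × L} (hc : LinearMap.ker c = Γ) {R : Submodule K V} {w : V} (hw : w ≠ 0) :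
    Projectivization.mk L w hw ∈ projectionPreimage Γ ℓ (pts L R) ↔
      ∃ u ∈ R, u ≠ 0 ∧ u ∈ ℓ ∧ ∃ l : L, l ≠ 0 ∧ c u = l • c w := by
  constructor
  · rintro ⟨_, ⟨u, hu, hu0, rfl⟩, h⟩
    exact ⟨u, hu, hu0, (projectsTo_mk_iff hd hc hw hu0).1 h⟩
  · rintro ⟨u, hu, hu0, h⟩
    exact ⟨_, ⟨u, hu, hu0, rfl⟩, (projectsTo_mk_iff hd hc hw hu0).2 h⟩

variable [Algebra K L]

theorem IsCanonicalSubgeometry.linearIndependent [IsScalarTower K L V] {U : Submodule L V}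
    {W : Submodule K V} (hW : IsCanonicalSubgeometry U W) {ι : Type*} [Fintype ι]
    (b : Module.Basis ι K W) : LinearIndependent L fun i => (b i : V) := by
  rw [linearIndependent_iff_card_eq_finrank_span, Set.finrank]
  have h1 : Submodule.span L (Set.range fun i => (b i : V)) = U := by
    rw [← hW.2]
    apply le_antisymm
    · exact Submodule.span_mono (by rintro _ ⟨i, rfl⟩; exact (b i).2)
    · rw [Submodule.span_le]
      intro w hw
      have h2 := congrArg W.subtype (b.sum_repr ⟨w, hw⟩)
      simp only [map_sum, map_smul, Submodule.subtype_apply] at h2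
      rw [← h2]
      refine Submodule.sum_mem _ fun i _ => ?_
      rw [← algebraMap_smul L]
      exact Submodule.smul_mem _ _ (Submodule.subset_span ⟨i, rfl⟩)
  rw [h1, ← hW.1, Module.finrank_eq_card_basis b]

/-- A `K`-basis of `W` is independent over `L`, so the factor can be read off as a ratio of
coordinates in `K`. -/
theorem IsCanonicalSubgeometry.exists_algebraMap_eq [IsScalarTower K L V] {U : Submodule L V}
    {W : Submodule K V} [FiniteDimensional K W] (hW : IsCanonicalSubgeometry U W) {w v : V}
    (hw : w ∈ W) (hv : v ∈ W) (hw0 : w ≠ 0) {l : L} (h : v = l • w) :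
    ∃ x : K, algebraMap K L x = l := by
  let b := Module.finBasis K W
  have hli := hW.linearIndependent b
  have hrepr : ∀ w : W, (w : V) = ∑ i, algebraMap K L (b.repr w i) • (b i : V) := by
    intro w
    have h2 := congrArg W.subtype (b.sum_repr w)
    simp only [map_sum, map_smul, Submodule.subtype_apply] at h2
    simp only [algebraMap_smul]
    exact h2.symm
  have h1 : ∀ i, algebraMap K L (b.repr ⟨v, hv⟩ i) = l * algebraMap K L (b.repr ⟨w, hw⟩ i) := by
    intro i
    have h3 := Fintype.linearIndependent_iff.1 hli (fun i => algebraMap K L (b.repr ⟨v, hv⟩ i)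
      - l * algebraMap K L (b.repr ⟨w, hw⟩ i)) (by
        simp only [sub_smul, Finset.sum_sub_distrib, mul_smul, ← Finset.smul_sum]
        rw [← hrepr ⟨v, hv⟩, ← hrepr ⟨w, hw⟩, sub_eq_zero]
        exact h) i
    exact sub_eq_zero.1 h3
  obtain ⟨i, hi⟩ : ∃ i, b.repr ⟨w, hw⟩ i ≠ 0 := by
    by_contra! hall
    apply hw0
    have := hrepr ⟨w, hw⟩
    simpa [hall] using this
  refine ⟨b.repr ⟨v, hv⟩ i / b.repr ⟨w, hw⟩ i, ?_⟩
  rw [map_div₀, h1, mul_div_cancel_right₀]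
  exact (map_ne_zero _).2 hi

theorem exists_eq_smul_of_span_singleton_eq {v w : V}
    (h : Submodule.span L {v} = Submodule.span L {w}) : ∃ l : L, l ≠ 0 ∧ v = l • w := by
  obtain ⟨z, hz⟩ := Submodule.span_singleton_eq_span_singleton.1 h.symm
  exact ⟨z, z.ne_zero, hz.symm⟩

theorem exists_parametrization_of_coordinate [IsScalarTower K L V] [FiniteDimensional K L] {W : Submodule K V}
    (hW : Module.finrank K W = Module.finrank K L) (c : V →ₗ[L] L)
    (hc : ∀ w ∈ W, w ≠ 0 → c w ≠ 0) :
    ∃ φ : L ≃ₗ[K] W, ∀ x, c (φ x : V) = x := by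
  have hpos : 0 < Module.finrank K W := hW ▸ Module.finrank_pos
  have : FiniteDimensional K W := FiniteDimensional.of_finrank_pos hpos
  let f : W →ₗ[K] L := c.restrictScalars K ∘ₗ W.subtype
  have hinj : Function.Injective f := by
    rw [← LinearMap.ker_eq_bot, LinearMap.ker_eq_bot']
    intro w hw
    by_contra hne
    exact hc w w.2 (by simpa using hne) hw
  have hsurj := (LinearMap.injective_iff_surjective_of_finrank_eq_finrank hW).1 hinj
  exact ⟨(LinearEquiv.ofBijective f ⟨hinj, hsurj⟩).symm, fun x =>
    (LinearEquiv.ofBijective f ⟨hinj, hsurj⟩).apply_symm_apply x⟩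

end Projection

/-! ### Coordinates from the pseudoregulus type -/

section Pseudoregulus

variable {K L V : Type*} [Field K] [Finite K] [Field L] [Algebra K L] [FiniteDimensional K L]
  [AddCommGroup V] [Module L V] [Module K V]

theorem relFrobenius_apply (x : L) : relFrobenius K L x = x ^ Nat.card K := by
  simpa using relFrobenius_pow_apply K L 1 x

/-- The map `c` is the projection onto `ℓ` along `Γ`, followed by the inverse of the given
projectivity. -/
theorem IsPseudoregulusType.exists_coordinates [FiniteDimensional L V] {W : Submodule K V}
    {Γ ℓ : Submodule L V} (hd : Disjoint Γ ℓ)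
    (hdim : Module.finrank L Γ + Module.finrank L ℓ = Module.finrank L V)
    (hWΓ : ∀ w ∈ W, w ≠ 0 → w ∉ Γ)
    (h : IsPseudoregulusType K ℓ (projection Γ ℓ (pts L W))) :
    ∃ c : V →ₗ[L] L × L, LinearMap.ker c = Γ ∧
      (∀ w ∈ W, w ≠ 0 → ∃ x l : L, x ≠ 0 ∧ l ≠ 0 ∧ c w = l • (x, relFrobenius K L x)) ∧
      ∀ x : L, x ≠ 0 → ∃ w ∈ W, w ≠ 0 ∧ ∃ l : L, l ≠ 0 ∧ c w = l • (x, relFrobenius K L x) := by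
  obtain ⟨g, hg, rfl, himg⟩ := h
  have hcompl : IsCompl (LinearMap.range g) Γ :=
    ⟨hd.symm, by rw [codisjoint_comm, codisjoint_iff]
                 exact Submodule.eq_top_of_disjoint _ _ hdim.ge hd⟩
  let pr : V →ₗ[L] (Fin 2 → L) :=
    (LinearEquiv.ofInjective g hg).symm.toLinearMap ∘ₗ Submodule.projectionOnto _ _ hcompl
  have hpr : ∀ v, pr (g v) = v := by
    intro v
    have h1 : Submodule.projectionOnto _ _ hcompl (g v) = LinearEquiv.ofInjective g hg v :=
      Submodule.projectionOnto_apply_left hcompl (LinearEquiv.ofInjective g hg v)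
    simp [pr, h1]
  have hker : LinearMap.ker pr = Γ := by
    rw [LinearEquiv.ker_comp, Submodule.ker_projectionOnto]
  let q : (Fin 2 → L) ≃ₗ[L] L × L := LinearEquiv.finTwoArrow L L
  let c : V →ₗ[L] L × L := q.toLinearMap ∘ₗ pr
  have hc : LinearMap.ker c = Γ := by rw [LinearEquiv.ker_comp, hker]
  have hcg : ∀ v, c (g v) = q v := fun v => congrArg q (hpr v)
  have hq : ∀ x y : L, q ![x, y] = (x, y) := fun x y => rfl
  refine ⟨c, hc, ?_, ?_⟩
  · intro w hw hw0
    have hcw : c w ≠ 0 := fun h0 => hWΓ w hw hw0 (hc ▸ LinearMap.mem_ker.2 h0)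
    have hu : g (q.symm (c w)) ≠ 0 := by
      rw [Ne, map_eq_zero_iff g hg, LinearEquiv.map_eq_zero_iff]
      exact hcw
    have hmem : Projectivization.mk L _ hu ∈ projection Γ (LinearMap.range g) (pts L W) := by
      rw [mk_mem_projection_iff hd hc]
      exact ⟨⟨_, rfl⟩, w, hw, hw0, 1, one_ne_zero, by rw [hcg]; simp⟩
    rw [← himg] at hmem
    obtain ⟨P, ⟨x, hx, hP⟩, hPu⟩ := hmem
    induction P using Projectivization.ind with | h v hv => ?_
    have h1 := congrArg Projectivization.submodule hPu
    rw [Projectivization.map_mk, Projectivization.submodule_mk, Projectivization.submodule_mk,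
      ← Set.image_singleton, ← Submodule.map_span, ← Projectivization.submodule_mk v hv, hP,
      Submodule.map_span,
      Set.image_singleton] at h1
    obtain ⟨l, hl, h2⟩ := exists_eq_smul_of_span_singleton_eq h1.symm
    refine ⟨x, l, hx, hl, ?_⟩
    have h3 := congrArg c h2
    rw [hcg, map_smul, LinearEquiv.apply_symm_apply] at h3
    rw [h3, relFrobenius_apply]
    erw [hcg, hq]
  · intro x hx
    have hv : (![x, relFrobenius K L x] : Fin 2 → L) ≠ 0 := fun h => hx (congrFun h 0)
    have hmem : Projectivization.mk L (g ![x, relFrobenius K L x])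
        (by rwa [Ne, map_eq_zero_iff g hg]) ∈ projection Γ (LinearMap.range g) (pts L W) := by
      rw [← himg]
      exact ⟨Projectivization.mk L _ hv,
        ⟨x, hx, by rw [Projectivization.submodule_mk, relFrobenius_apply]⟩,
        Projectivization.map_mk _ _ _ _⟩
    rw [mk_mem_projection_iff hd hc] at hmem
    obtain ⟨-, w, hw, hw0, l, hl, h⟩ := hmem
    refine ⟨w, hw, hw0, l⁻¹, inv_ne_zero hl, ?_⟩
    rw [hcg, hq] at h
    rw [h, smul_smul, inv_mul_cancel₀ hl, one_smul]

end Pseudoregulus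

/-! ### The vectors of conjugates -/

section PowVector

variable {K L : Type*} [Field K] [Field L] [Algebra K L]

/-- The linear map `x ↦ (x, x^σ, …, x^(σ^(t-1)))`. -/
def powVector (σ : L ≃ₐ[K] L) (t : ℕ) : L →ₗ[K] (Fin t → L) :=
  LinearMap.pi fun i => (σ ^ (i : ℕ)).toLinearMap

theorem powVector_apply (σ : L ≃ₐ[K] L) (t : ℕ) (x : L) (i : Fin t) :
    powVector σ t x i = (σ ^ (i : ℕ)) x := rfl

end PowVector

/-! ### Adapted coordinates: existence and parametrization -/

section Adapted

variable {K L V : Type*} [Field K] [Finite K] [Field L] [Algebra K L] [FiniteDimensional K L]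
  [AddCommGroup V] [Module L V]

theorem norm_relFrobenius_pow (s : ℕ) (x : L) :
    Algebra.norm K ((relFrobenius K L ^ s) x) = Algebra.norm K x :=
  (Algebra.norm_eq_of_algEquiv (relFrobenius K L ^ s) x)

theorem powVector_relFrobenius (t ν : ℕ) (x : L) :
    powVector (relFrobenius K L ^ ν) t x =
      fun i : Fin t => x ^ Nat.card K ^ (ν * (i : ℕ)) := by
  ext i
  rw [powVector_apply, ← pow_mul, relFrobenius_pow_apply]

theorem orderOf_relFrobenius_pow {t ν : ℕ} (hL : Module.finrank K L = t) (h : Nat.Coprime ν t) :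
    orderOf (relFrobenius K L ^ ν) = t := by
  rw [Nat.Coprime.orderOf_pow, orderOf_relFrobenius, hL]
  rwa [orderOf_relFrobenius, hL, Nat.coprime_comm]

theorem linearIndependent_powVector {σ : L ≃ₐ[K] L} {t : ℕ} (hσ : orderOf σ = t)
    (hL : Module.finrank K L = t) {ι : Type*} [Fintype ι] {x : ι → L}
    (hx : LinearIndependent K x) : LinearIndependent L fun i => powVector σ t (x i) :=
  linearIndependent_conjugates _ (pow_surjective_of_orderOf hσ hL) hx

theorem powVector_pair {σ : L ≃ₐ[K] L} {t : ℕ} (hσ : orderOf σ = t)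
    (hL : Module.finrank K L = t) {x y : L} (hxy : LinearIndependent K ![x, y]) {a b : L}
    (h : a • powVector σ t x + b • powVector σ t y = 0) : a = 0 ∧ b = 0 := by
  have h1 := Fintype.linearIndependent_iff.1 (linearIndependent_powVector hσ hL hxy) ![a, b]
    (by rw [Fin.sum_univ_two]; exact h)
  exact ⟨h1 0, h1 1⟩

theorem lastTwo_apply {t : ℕ} (ht : 2 ≤ t) (e : V ≃ₗ[L] (Fin t → L)) (v : V) :
    lastTwo ht e v = (e v ⟨t - 2, by omega⟩, e v ⟨t - 1, by omega⟩) := rfl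

theorem mem_standardSubgeometry_map_iff {t ν : ℕ} (e : V ≃ₗ[L] (Fin t → L)) {w : V} (hw : w ≠ 0) :
    Projectivization.map e.toLinearMap e.injective (Projectivization.mk L w hw) ∈
      standardSubgeometry K L t ν ↔
      ∃ x l : L, x ≠ 0 ∧ l ≠ 0 ∧ e w = l • powVector (relFrobenius K L ^ ν) t x := by
  constructor
  · rintro ⟨x, hx, h⟩
    rw [Projectivization.map_mk, Projectivization.submodule_mk, ← powVector_relFrobenius] at h
    obtain ⟨l, hl, h⟩ := exists_eq_smul_of_span_singleton_eq h
    exact ⟨x, l, hx, hl, h⟩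
  · rintro ⟨x, l, hx, hl, h⟩
    refine ⟨x, hx, ?_⟩
    rw [Projectivization.map_mk, Projectivization.submodule_mk, ← powVector_relFrobenius]
    change Submodule.span L {e w} = _
    rw [h, Submodule.span_singleton_smul_eq hl.isUnit]

variable [Module K V] [IsScalarTower K L V]

/-- Parametrized by the first coordinate of `c`, the subgeometry becomes the graph of a
norm-preserving map `f = f 1 • g`. The second half of the pseudoregulus condition makes `g` a
generator. -/
theorem exists_adapted {t : ℕ} (ht : 2 ≤ t) (hqt : t ≤ Nat.card K)
    (hL : Module.finrank K L = t) (hV : Module.finrank L V = t)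
    {W : Submodule K V} (hW : IsCanonicalSubgeometry (⊤ : Submodule L V) W)
    {Γ ℓ : Submodule L V} (hd : Disjoint Γ ℓ)
    (hdim : Module.finrank L Γ + Module.finrank L ℓ = Module.finrank L V)
    (hWΓ : ∀ w ∈ W, w ≠ 0 → w ∉ Γ)
    (h : IsPseudoregulusType K ℓ (projection Γ ℓ (pts L W))) :
    ∃ (ν : ℕ) (e : V ≃ₗ[L] (Fin t → L)), IsAdapted W Γ ht ν e := by
  have : FiniteDimensional L V := FiniteDimensional.of_finrank_pos (by omega)
  have hWL : Module.finrank K W = Module.finrank K L := by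
    rw [hW.1, finrank_top, hV, hL]
  obtain ⟨c, hc, hc1, hc2⟩ := h.exists_coordinates hd hdim hWΓ
  obtain ⟨φ, hφ⟩ := exists_parametrization_of_coordinate hWL (LinearMap.fst L L L ∘ₗ c) (by
    intro w hw hw0
    obtain ⟨x, l, hx, hl, h⟩ := hc1 w hw hw0
    simp [h, hx, hl])
  replace hφ : ∀ x, (c (φ x)).1 = x := hφ
  let f : L →ₗ[K] L := (LinearMap.snd L L L ∘ₗ c).restrictScalars K ∘ₗ W.subtype ∘ₗ φ.toLinearMap
  have hf : ∀ x, c (φ x) = (x, f x) := fun x => Prod.ext (hφ x) rfl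
  have hφ0 : ∀ x, x ≠ 0 → (φ x : V) ≠ 0 := by
    intro x hx
    simpa using hx
  have hnorm : ∀ x, Algebra.norm K (f x) = Algebra.norm K x := by
    intro x
    rcases eq_or_ne x 0 with rfl | hx
    · rw [map_zero]
    obtain ⟨y, l, hy, hl, h⟩ := hc1 _ (φ x).2 (hφ0 x hx)
    rw [hf, Prod.smul_mk, Prod.mk.injEq] at h
    rw [h.2, congrArg (Algebra.norm K) h.1, smul_eq_mul, smul_eq_mul, map_mul, map_mul]
    congr 1
    simpa using norm_relFrobenius_pow (K := K) 1 y
  obtain ⟨g, hg⟩ := exists_eq_mul_algEquiv_of_norm_eq (hL ▸ hqt) f hnorm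
  have hk : f 1 ≠ 0 := by
    intro h0
    have := hnorm 1
    rw [h0, Algebra.norm_zero, map_one] at this
    exact zero_ne_one this
  have hord : orderOf g = Module.finrank K L := by
    refine orderOf_eq_finrank_of_quotients g (f 1) fun x hx => ?_
    obtain ⟨w, hw, hw0, l, hl, h⟩ := hc2 x hx
    obtain ⟨y, hy⟩ := φ.surjective ⟨w, hw⟩
    have hy' : w = φ y := by rw [hy]
    subst hy'
    rw [hf, hg, Prod.smul_mk, Prod.mk.injEq, smul_eq_mul, smul_eq_mul] at h
    have hy0 : y ≠ 0 := by
      rintro rfl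
      exact hw0 (by simp)
    refine ⟨y, hy0, ?_⟩
    rw [← mul_div_assoc, h.2, h.1, mul_div_mul_left _ _ hl]
  obtain ⟨ν, hνt, rfl⟩ := exists_relFrobenius_pow_eq g
  have hcop : Nat.Coprime ν t := by
    have h1 : t ≠ 0 := by omega
    have h2 := orderOf_pow (n := ν) (relFrobenius K L)
    rw [hord, orderOf_relFrobenius, hL] at h2
    rw [Nat.coprime_iff_gcd_eq_one, Nat.gcd_comm]
    have h3 := Nat.div_mul_cancel (Nat.gcd_dvd_left t ν)
    rw [← h2] at h3
    exact Nat.eq_of_mul_eq_mul_left (by omega : 0 < t) (by omega)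
  rw [hL] at hord
  refine ⟨ν, ?_⟩
  set σ := relFrobenius K L ^ ν with hσ
  -- Reparametrizing by `σ^(t-2)` makes the two coordinates of `c` the last two entries of
  -- `powVector`, up to the factor `f 1`.
  let ψ : L ≃ₗ[K] W := (σ ^ (t - 2)).toLinearEquiv.trans φ
  have hψ : ∀ x, c (ψ x) = ((σ ^ (t - 2)) x, f 1 * (σ ^ (t - 1)) x) := by
    intro x
    change c (φ ((σ ^ (t - 2)) x)) = _
    rw [hf, hg, ← AlgEquiv.mul_apply, ← pow_succ', show t - 2 + 1 = t - 1 by omega]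
  let b := Module.finBasisOfFinrankEq K L hL
  have hcard : Fintype.card (Fin t) = t := Fintype.card_fin t
  have : Nonempty (Fin t) := ⟨⟨0, by omega⟩⟩
  let bV := basisOfLinearIndependentOfCardEqFinrank (hW.linearIndependent (b.map ψ))
    (by rw [hcard, hV])
  let bE := basisOfLinearIndependentOfCardEqFinrank
    (linearIndependent_powVector hord hL b.linearIndependent)
    (by rw [hcard, Module.finrank_fin_fun])
  let e := bV.equiv bE (Equiv.refl _)
  have he : ∀ x, e (ψ x) = powVector σ t x := by
    have h1 : e.toLinearMap.restrictScalars K ∘ₗ W.subtype ∘ₗ ψ.toLinearMap = powVector σ t := by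
      apply b.ext
      intro i
      have h2 : ((ψ (b i) : W) : V) = bV i := by simp [bV]
      change e (ψ (b i) : V) = _
      rw [h2, Module.Basis.equiv_apply]
      simp [bE]
    exact fun x => LinearMap.congr_fun h1 x
  refine ⟨e, hcop, ?_, ?_⟩
  · apply Set.eq_of_subset_of_subset
    · rintro _ ⟨_, ⟨w, hw, hw0, rfl⟩, rfl⟩
      rw [mem_standardSubgeometry_map_iff]
      obtain ⟨x, hx⟩ := ψ.surjective ⟨w, hw⟩
      have hx' : w = ψ x := by rw [hx]
      subst hx'
      exact ⟨x, 1, by rintro rfl; exact hw0 (by simp), one_ne_zero, by rw [he, one_smul]⟩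
    · rintro P ⟨x, hx, hP⟩
      have hx0 : (ψ x : V) ≠ 0 := by simpa using hx
      refine ⟨_, ⟨ψ x, (ψ x).2, hx0, rfl⟩, ?_⟩
      apply Projectivization.submodule_injective
      rw [Projectivization.map_mk, Projectivization.submodule_mk, hP, ← powVector_relFrobenius,
        ← hσ, ← he]
      rfl
  · let m : L × L →ₗ[L] L × L := LinearMap.prodMap LinearMap.id (f 1 • LinearMap.id)
    have hm : c = m ∘ₗ lastTwo ht e := by
      apply LinearMap.ext_on hW.2
      intro w hw
      obtain ⟨x, hx⟩ := ψ.surjective ⟨w, hw⟩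
      have hx' : w = ψ x := by rw [hx]
      subst hx'
      rw [LinearMap.comp_apply, lastTwo_apply, he]
      exact hψ x
    rw [← hc, hm, LinearMap.ker_comp_of_ker_eq_bot]
    rw [LinearMap.ker_eq_bot']
    rintro ⟨x, y⟩ hxy
    simpa [m, hk] using hxy

/-- Adapted coordinates parametrize the vectors of the subgeometry, up to a common factor. -/
theorem IsAdapted.exists_smul_powVector {t ν : ℕ} {ht : 2 ≤ t} (hL : Module.finrank K L = t)
    (hV : Module.finrank L V = t) {W : Submodule K V} {Γ : Submodule L V}
    (hW : IsCanonicalSubgeometry (⊤ : Submodule L V) W) {e : V ≃ₗ[L] (Fin t → L)}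
    (he : IsAdapted W Γ ht ν e) :
    ∃ l : L, l ≠ 0 ∧ ∀ w ∈ W, ∃ x, e w = l • powVector (relFrobenius K L ^ ν) t x := by
  have hWt : Module.finrank K W = t := by rw [hW.1, finrank_top, hV]
  have : FiniteDimensional K W := FiniteDimensional.of_finrank_pos (by omega)
  have hord := orderOf_relFrobenius_pow hL he.coprime
  have key : ∀ w ∈ W, w ≠ 0 →
      ∃ x l : L, x ≠ 0 ∧ l ≠ 0 ∧ e w = l • powVector (relFrobenius K L ^ ν) t x := by
    intro w hw hw0
    rw [← mem_standardSubgeometry_map_iff e hw0, ← he.subgeometry]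
    exact ⟨_, ⟨w, hw, hw0, rfl⟩, rfl⟩
  set Φ := powVector (relFrobenius K L ^ ν) t
  obtain ⟨w₀, hw₀, hw₀0⟩ : ∃ w ∈ W, w ≠ 0 := by
    apply W.ne_bot_iff.1
    rintro rfl
    rw [finrank_bot] at hWt
    omega
  obtain ⟨x₀, l₀, hx₀, hl₀, h₀⟩ := key w₀ hw₀ hw₀0
  refine ⟨l₀, hl₀, fun w hw => ?_⟩
  rcases eq_or_ne w 0 with rfl | hw0
  · exact ⟨0, by simp⟩
  -- Equality of point sets gives each vector its own factor. It is compared with that of `w₀`: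
  -- directly if the labels are proportional over `K`, otherwise through `w + w₀`, whose label must
  -- lie in the span of the other two.
  obtain ⟨x, l, hx, hl, h⟩ := key w hw hw0
  by_cases hdep : ∃ y : K, y • x₀ = x
  · obtain ⟨y, rfl⟩ := hdep
    have h1 : w = (l * algebraMap K L y * l₀⁻¹) • w₀ := by
      apply e.injective
      rw [map_smul, h₀, h, map_smul, ← algebraMap_smul L y, smul_smul, smul_smul, mul_assoc,
        mul_assoc, inv_mul_cancel₀ hl₀, mul_one]
    obtain ⟨z, hz⟩ := hW.exists_algebraMap_eq hw₀ hw hw₀0 h1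
    refine ⟨z • x₀, ?_⟩
    rw [h1, ← hz, map_smul, h₀, map_smul, algebraMap_smul, smul_comm]
  push Not at hdep
  have hli : LinearIndependent K ![x, x₀] := by
    rw [LinearIndependent.pair_iff' hx]
    intro y hy
    have hy0 : y ≠ 0 := by rintro rfl; exact hx₀ (by rw [← hy, zero_smul])
    exact hdep y⁻¹ (by rw [← hy, inv_smul_smul₀ hy0])
  have hsum : w + w₀ ≠ 0 := by
    intro hs
    have h1 : l • Φ x + l₀ • Φ x₀ = 0 := by rw [← h, ← h₀, ← map_add, hs, map_zero]
    exact hl (powVector_pair hord hL hli h1).1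
  obtain ⟨x', l', hx', hl', h'⟩ := key (w + w₀) (W.add_mem hw hw₀) hsum
  have h1 : l' • Φ x' = l • Φ x + l₀ • Φ x₀ := by rw [← h, ← h₀, ← map_add, h']
  have hmem : x' ∈ Submodule.span K {x, x₀} := by
    by_contra hn
    have h2 : LinearIndependent K (Fin.cons x' ![x, x₀] : Fin 3 → L) :=
      linearIndependent_finCons.2 ⟨hli, by rwa [Matrix.range_cons_cons_empty]⟩
    have h3 := Fintype.linearIndependent_iff.1 (linearIndependent_powVector hord hL h2)
      ![l', -l, -l₀] (by
        rw [Fin.sum_univ_three]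
        change l' • Φ x' + -l • Φ x + -l₀ • Φ x₀ = 0
        rw [h1]
        module) 0
    exact hl' h3
  obtain ⟨y, z, rfl⟩ := Submodule.mem_span_pair.1 hmem
  obtain ⟨h2, h3⟩ := powVector_pair hord hL hli
    (a := l' * algebraMap K L y - l) (b := l' * algebraMap K L z - l₀) (by
    rw [map_add, map_smul, map_smul, ← algebraMap_smul L y, ← algebraMap_smul L z,
      ← sub_eq_zero] at h1
    rw [← h1]
    module)
  rw [sub_eq_zero] at h2 h3
  refine ⟨(y / z) • x, ?_⟩
  have hz : algebraMap K L z ≠ 0 := by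
    intro hz
    rw [hz, mul_zero] at h3
    exact hl₀ h3.symm
  rw [h, map_smul, ← algebraMap_smul L (y / z), smul_smul, map_div₀, ← h2, ← h3]
  congr 1
  field_simp

theorem IsAdapted.exists_parametrization {t ν : ℕ} {ht : 2 ≤ t} (hL : Module.finrank K L = t)
    (hV : Module.finrank L V = t) {W : Submodule K V} {Γ : Submodule L V}
    (hW : IsCanonicalSubgeometry (⊤ : Submodule L V) W) {e : V ≃ₗ[L] (Fin t → L)}
    (he : IsAdapted W Γ ht ν e) :
    ∃ (l : L) (φ : L ≃ₗ[K] W), l ≠ 0 ∧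
      ∀ x, lastTwo ht e (φ x) = l • (x, (relFrobenius K L ^ ν) x) := by
  obtain ⟨l, hl, h⟩ := he.exists_smul_powVector hL hV hW
  set σ := relFrobenius K L ^ ν
  have h' : ∀ w ∈ W, ∃ x, lastTwo ht e w = l • (x, σ x) ∧ (x = 0 → w = 0) := by
    intro w hw
    obtain ⟨x, hx⟩ := h w hw
    -- The new label is the next to last entry, so the last one is its image under `σ`.
    refine ⟨(σ ^ (t - 2)) x, ?_, fun h0 => ?_⟩
    · rw [lastTwo_apply, hx, ← AlgEquiv.mul_apply, ← pow_succ', show t - 2 + 1 = t - 1 by omega]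
      rfl
    · rw [map_eq_zero_iff _ (σ ^ (t - 2)).injective] at h0
      rw [h0, map_zero, smul_zero] at hx
      exact e.map_eq_zero_iff.1 hx
  have hWL : Module.finrank K W = Module.finrank K L := by
    rw [hW.1, finrank_top, hV, hL]
  obtain ⟨φ, hφ⟩ := exists_parametrization_of_coordinate hWL (l⁻¹ • (LinearMap.fst L L L ∘ₗ lastTwo ht e)) (by
    intro w hw hw0
    obtain ⟨x, hx, hx0⟩ := h' w hw
    have : x ≠ 0 := fun h0 => hw0 (hx0 h0)
    simpa [hx, hl] using this)
  refine ⟨l, φ, hl, fun x => ?_⟩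
  obtain ⟨y, hy, -⟩ := h' (φ x) (φ x).2
  have h1 := hφ x
  simp only [LinearMap.smul_apply, LinearMap.comp_apply, hy, LinearMap.fst_apply, Prod.smul_mk,
    smul_eq_mul, inv_mul_cancel_left₀ hl] at h1
  rw [hy, h1]

end Adapted

/-! ### Sublines as twisted pairs -/

section Twisted

variable {K L V : Type*} [Field K] [Field L] [Algebra K L]
  [AddCommGroup V] [Module L V] [Module K V]

/-- In the coordinates `c`, the vectors of `R` are the multiples by a common factor of the vectors
`(z, d z^g)`, where `z` lies in the `K`-subspace `⟨1, a⟩` of `L` and `d ≠ 0` is fixed. -/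
def IsTwistedPair (c : V →ₗ[L] L × L) (R : Submodule K V) (a : L) (g : L ≃ₐ[K] L) : Prop :=
  ∃ (u v : V) (p p' : L), R = Submodule.span K {u, v} ∧ p ≠ 0 ∧ p' ≠ 0 ∧
    c u = (p, p') ∧ c v = (p * a, p' * g a)

variable [IsScalarTower K L V]

theorem map_pair_eq {c : V →ₗ[L] L × L} {u v : V} {p p' a : L} {g : L ≃ₐ[K] L}
    (hu : c u = (p, p')) (hv : c v = (p * a, p' * g a)) (x y : K) :
    c (x • u + y • v) = (p * (algebraMap K L x + algebraMap K L y * a),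
      p' * g (algebraMap K L x + algebraMap K L y * a)) := by
  rw [map_add, ← algebraMap_smul L x, ← algebraMap_smul L y, map_smul, map_smul, hu, hv]
  simp only [Prod.smul_mk, Prod.mk_add_mk, smul_eq_mul, map_add, map_mul, AlgEquiv.commutes]
  ext <;> simp only <;> ring

/-- A change of basis of `R` makes `a'` a fractional linear function of `a` over `K`. Automorphisms
commute with such functions, and the second coordinates satisfy the same formula. -/
theorem IsTwistedPair.apply_eq {c : V →ₗ[L] L × L} {R : Submodule K V} {a a' : L}
    {g g' : L ≃ₐ[K] L} (h : IsTwistedPair c R a g) (h' : IsTwistedPair c R a' g') :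
    g' a' = g a' ∧ ∀ s s' : L ≃ₐ[K] L, s a = s' a → s a' = s' a' := by
  obtain ⟨u, v, p, q, rfl, hp, hq, hu, hv⟩ := h
  obtain ⟨u', v', p', q', hR, hp', hq', hu', hv'⟩ := h'
  obtain ⟨x, y, rfl⟩ := Submodule.mem_span_pair.1
    (hR ▸ Submodule.subset_span (by simp) : u' ∈ Submodule.span K {u, v})
  obtain ⟨z, w, rfl⟩ := Submodule.mem_span_pair.1
    (hR ▸ Submodule.subset_span (by simp) : v' ∈ Submodule.span K {u, v})
  rw [map_pair_eq hu hv, Prod.mk.injEq] at hu' hv'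
  obtain ⟨h1, h2⟩ := hu'
  obtain ⟨h3, h4⟩ := hv'
  set m := algebraMap K L x + algebraMap K L y * a with hm
  set n := algebraMap K L z + algebraMap K L w * a with hn
  have hm0 : m ≠ 0 := by
    intro h0
    rw [h0, mul_zero] at h1
    exact hp' h1.symm
  have ha' : a' = n / m := by
    rw [eq_div_iff hm0]
    apply mul_left_cancel₀ hp
    rw [h3, ← h1]
    ring
  constructor
  · rw [ha', map_div₀ g, eq_div_iff ((map_ne_zero g).2 hm0), ← ha']
    apply mul_left_cancel₀ hq
    rw [h4, ← h2]
    ring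
  · intro s s' hs
    rw [ha', map_div₀, map_div₀]
    simp [hm, hn, hs]

variable [Finite K] [FiniteDimensional K L]

/-- For basis vectors `b 0`, `b 1`, the norms on `b 1 + y • b 0` compare all `K`-translates of the
two coordinate ratios. If `g` fixed `a`, the basis vectors would be proportional over `L`. -/
theorem exists_isTwistedPair (hq : Module.finrank K L ≤ Nat.card K) {c : V →ₗ[L] L × L}
    {ℓ : Submodule L V} (hℓ : Module.finrank L ℓ = 2) {R : Submodule K V}
    (hR : IsCanonicalSubgeometry ℓ R) (hcℓ : ∀ v ∈ ℓ, c v = 0 → v = 0)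
    (hN : ∀ u ∈ R, u ≠ 0 → Algebra.norm K (c u).1 = Algebra.norm K (c u).2 ∧
      (c u).1 ≠ 0 ∧ (c u).2 ≠ 0) :
    ∃ (a : L) (g : L ≃ₐ[K] L), IsTwistedPair c R a g ∧ g a ≠ a := by
  have hR2 : Module.finrank K R = 2 := hR.1.trans hℓ
  have : FiniteDimensional K R := FiniteDimensional.of_finrank_pos (by omega)
  let b := Module.finBasisOfFinrankEq K R hR2
  have hli := hR.linearIndependent b
  have hb0 : (b 0 : V) ≠ 0 := hli.ne_zero 0
  have hRℓ : ∀ u ∈ R, u ∈ ℓ := fun u hu => hR.2 ▸ Submodule.subset_span hu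
  obtain ⟨hN0, hp, hp'⟩ := hN _ (b 0).2 hb0
  set p := (c (b 0)).1
  set p' := (c (b 0)).2
  have hsum : ∀ y : K, Algebra.norm K ((c (b 1)).1 / p + algebraMap K L y) =
      Algebra.norm K ((c (b 1)).2 / p' + algebraMap K L y) := by
    intro y
    have hne : b 1 + y • b 0 ≠ 0 := by
      intro h0
      have h1 := Fintype.linearIndependent_iff.1 b.linearIndependent ![y, 1]
        (by rw [Fin.sum_univ_two]; simpa [add_comm] using h0) 1
      exact one_ne_zero h1
    have h1 := (hN _ (b 1 + y • b 0).2 fun h0 => hne (Subtype.ext h0)).1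
    have h2 : c ((b 1 + y • b 0 : R) : V) =
        (p * ((c (b 1)).1 / p + algebraMap K L y), p' * ((c (b 1)).2 / p' + algebraMap K L y)) := by
      rw [Submodule.coe_add, Submodule.coe_smul, map_add, ← algebraMap_smul L y, map_smul]
      ext
      · simp only [Prod.fst_add, Prod.smul_fst, smul_eq_mul, mul_add, mul_div_cancel₀ _ hp]
        rw [mul_comm p]
      · simp only [Prod.snd_add, Prod.smul_snd, smul_eq_mul, mul_add, mul_div_cancel₀ _ hp']
        rw [mul_comm p']
    rw [h2, map_mul, map_mul, ← hN0] at h1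
    exact mul_left_cancel₀ (Algebra.norm_ne_zero_iff.2 hp) h1
  obtain ⟨g, hg⟩ := exists_algEquiv_of_norm_add_eq hq hsum
  have hv : c (b 1) = (p * ((c (b 1)).1 / p), p' * g ((c (b 1)).1 / p)) := by
    rw [← hg, mul_div_cancel₀ _ hp, mul_div_cancel₀ _ hp']
  refine ⟨(c (b 1)).1 / p, g, ⟨b 0, b 1, p, p', ?_, hp, hp', rfl, hv⟩, ?_⟩
  · have h1 := congrArg (Submodule.map R.subtype) b.span_eq
    rw [Submodule.map_span, Submodule.map_subtype_top] at h1
    refine h1.symm.trans (congrArg (Submodule.span K) ?_)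
    ext w
    simp [Fin.exists_fin_two, eq_comm]
  · intro hga
    rw [hga] at hv
    have h1 : (b 1 : V) - ((c (b 1)).1 / p) • (b 0 : V) = 0 := by
      apply hcℓ _ (ℓ.sub_mem (hRℓ _ (b 1).2) (ℓ.smul_mem _ (hRℓ _ (b 0).2)))
      rw [map_sub, map_smul, sub_eq_zero]
      refine hv.trans ?_
      ext
      · exact mul_comm _ _
      · exact mul_comm _ _
    have h2 := Fintype.linearIndependent_iff.1 hli ![-((c (b 1)).1 / p), 1]
      (by rw [Fin.sum_univ_two, ← h1]; simp [sub_eq_add_neg, add_comm]) 1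
    exact one_ne_zero h2

theorem IsTwistedPair.hasTransversalInFamily {c : V →ₗ[L] L × L} {R : Submodule K V} {a : L}
    {h : ℕ} (hR2 : Module.finrank K R = 2) (hcR : ∀ v ∈ R, c v = 0 → v = 0)
    (hN : ∀ u ∈ R, u ≠ 0 → Algebra.norm K (c u).1 = Algebra.norm K (c u).2)
    (hT : IsTwistedPair c R a (relFrobenius K L ^ h)) :
    HasTransversalInFamily K c (pts L R) h := by
  obtain ⟨u, v, p, p', rfl, hp, hp', hu, hv⟩ := hT
  let f : V →ₗ[K] L × L := (p⁻¹ • c).restrictScalars K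
  have hf : ∀ w, f w = p⁻¹ • c w := fun w => rfl
  have hf0 : ∀ w ∈ Submodule.span K {u, v}, f w = 0 → w = 0 := by
    intro w hw h0
    apply hcR w hw
    rw [hf, smul_eq_zero] at h0
    exact h0.resolve_left (inv_ne_zero hp)
  -- Scaling by `p⁻¹` turns the coordinates into `(z, (p'/p) g z)`, and `p'/p` has norm `1`.
  refine ⟨(Submodule.span K {u, v}).map f, p' / p, ⟨?_, ?_⟩, ?_, ?_⟩
  · rw [← LinearMap.range_domRestrict, LinearMap.finrank_range_of_inj, hR2]
    rw [← LinearMap.ker_eq_bot, LinearMap.ker_eq_bot']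
    exact fun w hw => Subtype.ext (hf0 w w.2 hw)
  · rintro _ ⟨w, hw, hw0, rfl⟩
    rw [Submodule.ne_bot_iff]
    refine ⟨f w, ⟨⟨w, hw, rfl⟩, ?_⟩, fun h0 => hw0 (hf0 w hw h0)⟩
    refine ⟨p⁻¹ • w, ?_, by rw [map_smul]; rfl⟩
    rw [Projectivization.submodule_mk]
    exact Submodule.smul_mem _ _ (Submodule.mem_span_singleton_self w)
  · have hu0 : u ≠ 0 := by
      rintro rfl
      rw [map_zero] at hu
      exact hp (congrArg Prod.fst hu).symm
    have h1 := hN u (Submodule.subset_span (by simp)) hu0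
    rw [hu] at h1
    have h2 : p' = p * (p' / p) := by field_simp
    have h3 := congrArg (Algebra.norm K) h2
    rw [map_mul, ← h1] at h3
    exact (mul_eq_left₀ (Algebra.norm_ne_zero_iff.2 hp)).1 h3.symm
  · rintro _ ⟨w, hw, rfl⟩
    obtain ⟨x, y, rfl⟩ := Submodule.mem_span_pair.1 hw
    refine ⟨algebraMap K L x + algebraMap K L y * a, ?_⟩
    rw [hf, map_pair_eq hu hv, ← relFrobenius_pow_apply]
    ext
    · simp [hp]
    · simp only [Prod.smul_mk, smul_eq_mul]
      ring

end Twisted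

/-! ### From transversals back to twisted pairs -/

section Transversal

variable {K L V : Type*} [Field K] [Finite K] [Field L] [Algebra K L] [FiniteDimensional K L]
  [AddCommGroup V] [Module L V] [Module K V]

/-- The transversal contains `L`-multiples of `c u`, `c v` and `c (u + v)`. The third forces the
factors of the first two to be `K`-proportional, so one common factor works for both and the family
member gives the twisted form. -/
theorem IsTwistedPair.of_hasTransversalInFamily {c : V →ₗ[L] L × L} {R : Submodule K V} {a : L}
    {g : L ≃ₐ[K] L} {h : ℕ} (hga : g a ≠ a) (hT : IsTwistedPair c R a g)
    (hF : HasTransversalInFamily K c (pts L R) h) :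
    ∃ a', IsTwistedPair c R a' (relFrobenius K L ^ h) := by
  obtain ⟨u, v, p, p', rfl, hp, hp', hu, hv⟩ := hT
  obtain ⟨f, k, ⟨hf2, hmeet⟩, hk, hsub⟩ := hF
  have hk0 : k ≠ 0 := by
    rintro rfl
    rw [Algebra.norm_zero] at hk
    exact zero_ne_one hk
  have hpair : ∀ x y : L, x • c u + y • c v = 0 → x = 0 ∧ y = 0 := by
    intro x y hxy
    rw [hu, hv, Prod.smul_mk, Prod.smul_mk, Prod.mk_add_mk, Prod.mk_eq_zero] at hxy
    simp only [smul_eq_mul] at hxy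
    have h1 : x + y * a = 0 := by
      apply mul_left_cancel₀ hp
      linear_combination hxy.1
    have h2 : x + y * g a = 0 := by
      apply mul_left_cancel₀ hp'
      linear_combination hxy.2
    have h3 : y * (g a - a) = 0 := by linear_combination h2 - h1
    have hy : y = 0 := (mul_eq_zero.1 h3).resolve_right (sub_ne_zero.2 hga)
    rw [hy, zero_mul, add_zero] at h1
    exact ⟨h1, hy⟩
  have hpt : ∀ w ∈ Submodule.span K {u, v}, w ≠ 0 → ∃ l : L, l ≠ 0 ∧ l • c w ∈ f := by
    intro w hw hw0
    obtain ⟨z, ⟨hz1, hz2⟩, hz0⟩ := (Submodule.ne_bot_iff _).1 (hmeet _ ⟨w, hw, hw0, rfl⟩)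
    obtain ⟨w', hw', rfl⟩ := hz2
    rw [Projectivization.submodule_mk] at hw'
    obtain ⟨l, rfl⟩ := Submodule.mem_span_singleton.1 hw'
    rw [map_smul] at hz1 hz0
    exact ⟨l, fun h0 => hz0 (by rw [h0, zero_smul]), hz1⟩
  have hcu : u ≠ 0 := by
    rintro rfl
    exact one_ne_zero (hpair 1 0 (by simp)).1
  have hcv : v ≠ 0 := by
    rintro rfl
    exact one_ne_zero (hpair 0 1 (by simp)).2
  have hcuv : u + v ≠ 0 := by
    intro h0
    exact one_ne_zero (hpair 1 1 (by rw [one_smul, one_smul, ← map_add, h0, map_zero])).1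
  have huR : u ∈ Submodule.span K {u, v} := Submodule.subset_span (by simp)
  have hvR : v ∈ Submodule.span K {u, v} := Submodule.subset_span (by simp)
  obtain ⟨l₁, hl₁, h₁⟩ := hpt u huR hcu
  obtain ⟨l₂, hl₂, h₂⟩ := hpt v hvR hcv
  obtain ⟨l₃, hl₃, h₃⟩ := hpt (u + v) (Submodule.add_mem _ huR hvR) hcuv
  have hspan : Submodule.span K {l₁ • c u, l₂ • c v} = f := by
    have hli : LinearIndependent K ![l₁ • c u, l₂ • c v] := by
      rw [LinearIndependent.pair_iff]
      intro x y hxy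
      rw [← algebraMap_smul L x, ← algebraMap_smul L y, smul_smul, smul_smul] at hxy
      have := hpair _ _ hxy
      simpa [hl₁, hl₂] using this
    have hfin : FiniteDimensional K f := FiniteDimensional.of_finrank_pos (by omega)
    apply Submodule.eq_of_le_of_finrank_eq
    · rw [Submodule.span_le]
      rintro _ (rfl | rfl)
      exacts [h₁, h₂]
    · rw [hf2, ← Matrix.range_cons_cons_empty, finrank_span_eq_card hli, Fintype.card_fin]
  rw [← hspan] at h₃
  obtain ⟨x, y, hxy⟩ := Submodule.mem_span_pair.1 h₃
  obtain ⟨h4, h5⟩ := hpair (algebraMap K L x * l₁ - l₃) (algebraMap K L y * l₂ - l₃) (by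
    rw [← sub_eq_zero, ← algebraMap_smul L x, ← algebraMap_smul L y, map_add] at hxy
    rw [← hxy]
    module)
  rw [sub_eq_zero] at h4 h5
  have hx : x ≠ 0 := by
    rintro rfl
    rw [map_zero, zero_mul] at h4
    exact hl₃ h4.symm
  have h6 : l₁ • c v ∈ f := by
    have h7 : l₁ • c v = (y / x) • l₂ • c v := by
      rw [← algebraMap_smul L (y / x), smul_smul, map_div₀]
      congr 1
      have : algebraMap K L x ≠ 0 := (map_ne_zero _).2 hx
      field_simp
      linear_combination h4 - h5
    rw [h7]
    exact f.smul_mem _ h₂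
  obtain ⟨z, hz⟩ := hsub h₁
  obtain ⟨z', hz'⟩ := hsub h6
  rw [← relFrobenius_pow_apply] at hz hz'
  set s := relFrobenius K L ^ h
  have hz0 : z ≠ 0 := by
    rintro rfl
    rw [map_zero, mul_zero] at hz
    exact hl₁ (hpair l₁ 0 (by rw [hz]; simp)).1
  refine ⟨z' / z, u, v, l₁⁻¹ * z, l₁⁻¹ * (k * s z), rfl, mul_ne_zero (inv_ne_zero hl₁) hz0,
    mul_ne_zero (inv_ne_zero hl₁) (mul_ne_zero hk0 ((map_ne_zero s).2 hz0)), ?_, ?_⟩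
  · rw [← inv_smul_smul₀ hl₁ (c u), hz]
    rfl
  · rw [← inv_smul_smul₀ hl₁ (c v), hz', map_div₀]
    have : s z ≠ 0 := (map_ne_zero s).2 hz0
    ext
    · simp only [Prod.smul_mk, smul_eq_mul]
      field_simp
    · simp only [Prod.smul_mk, smul_eq_mul]
      field_simp

end Transversal

/-! ### The preimage of a subline is a normal rational curve -/

section Curve

variable {K L V : Type*} [Field K] [Finite K] [Field L] [Algebra K L] [FiniteDimensional K L]
  [AddCommGroup V] [Module L V] [Module K V] [IsScalarTower K L V]

/-- By telescoping, `x / (d Π)` is fixed by the generator `σ`. The converse is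
`quotient_of_eq_algebraMap_mul`. -/
theorem exists_eq_algebraMap_mul_of_quotient {σ : L ≃ₐ[K] L}
    (hσ : orderOf σ = Module.finrank K L) {d x z : L} {n : ℕ} (hd : d ≠ 0) (hz : z ≠ 0)
    (h : σ d * (σ ^ n) z * x = d * z * σ x) :
    ∃ k : K, x = algebraMap K L k * (d * ∏ l ∈ Finset.range n, (σ ^ l) z) := by
  have hpi := map_prod_conj_mul σ n z
  have hpi0 : ∏ l ∈ Finset.range n, (σ ^ l) z ≠ 0 :=
    Finset.prod_ne_zero_iff.2 fun l _ => (map_ne_zero _).2 hz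
  set p := ∏ l ∈ Finset.range n, (σ ^ l) z
  have hfix : σ (x / (d * p)) = x / (d * p) := by
    rw [map_div₀, map_mul, div_eq_div_iff (mul_ne_zero ((map_ne_zero σ).2 hd)
      ((map_ne_zero σ).2 hpi0)) (mul_ne_zero hd hpi0)]
    apply mul_left_cancel₀ hz
    linear_combination (-p) * h - x * σ d * hpi
  obtain ⟨k, hk⟩ := exists_eq_algebraMap_of_apply_eq hσ hfix
  exact ⟨k, by rw [hk, div_mul_cancel₀ _ (mul_ne_zero hd hpi0)]⟩

theorem isNormalRationalCurve_inter_projectionPreimage {Γ ℓ : Submodule L V} (hd : Disjoint Γ ℓ)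
    {c : V →ₗ[L] L × L} (hc : LinearMap.ker c = Γ) {σ : L ≃ₐ[K] L}
    (hσ : orderOf σ = Module.finrank K L) {W : Submodule K V} (φ : L ≃ₗ[K] W) {l₀ : L}
    (hl₀ : l₀ ≠ 0) (hφ : ∀ x, c (φ x) = l₀ • (x, σ x)) {R : Submodule K V} (hRℓ : ∀ u ∈ R, u ∈ ℓ)
    (hRsub : pts L R ⊆ projection Γ ℓ (pts L W)) {a : L} {g : L ≃ₐ[K] L}
    (hT : IsTwistedPair c R a g) {n : ℕ} (hn : 1 ≤ n) (hgn : (σ ^ n) a = g a)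
    (ha : ∀ k, 0 < k → k ≤ n → (σ ^ k) a ≠ a) :
    IsNormalRationalCurve W n (pts L W ∩ projectionPreimage Γ ℓ (pts L R)) := by
  obtain ⟨u, v, p, p', rfl, hp, hp', hu, hv⟩ := hT
  have haK : ∀ x : K, algebraMap K L x ≠ a := by
    rintro x rfl
    exact ha 1 one_pos hn (AlgEquiv.commutes _ _)
  have hz0 : ∀ x y : K, algebraMap K L x + algebraMap K L y * a = 0 → x = 0 ∧ y = 0 := by
    intro x y h0
    have hy : y = 0 := by
      by_contra hy
      apply haK (-x / y)
      have : algebraMap K L y ≠ 0 := (map_ne_zero _).2 hy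
      rw [map_div₀, map_neg]
      field_simp
      linear_combination -h0
    rw [hy, map_zero, zero_mul, add_zero, map_eq_zero] at h0
    exact ⟨h0, hy⟩
  have hgz : ∀ x y : K, g (algebraMap K L x + algebraMap K L y * a) =
      (σ ^ n) (algebraMap K L x + algebraMap K L y * a) := by
    intro x y
    simp only [map_add, map_mul, AlgEquiv.commutes, hgn]
  -- The label of a point of the subgeometry that projects to `⟨u⟩` exhibits `p'/p` as `σ d / d`.
  obtain ⟨d, hd0, hpd⟩ : ∃ d : L, d ≠ 0 ∧ p' * d = p * σ d := by
    have hu0 : u ≠ 0 := by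
      rintro rfl
      rw [map_zero] at hu
      exact hp (congrArg Prod.fst hu).symm
    obtain ⟨-, w, hw, hw0, l, hl, h⟩ := (mk_mem_projection_iff hd hc hu0).1
      (hRsub ⟨u, Submodule.subset_span (by simp), hu0, rfl⟩)
    obtain ⟨d, hd'⟩ := φ.surjective ⟨w, hw⟩
    have hwd : w = φ d := by rw [hd']
    subst hwd
    rw [hu, hφ, smul_smul, Prod.smul_mk, Prod.mk.injEq, smul_eq_mul, smul_eq_mul] at h
    refine ⟨d, by rintro rfl; exact hw0 (by simp), ?_⟩
    rw [h.1, h.2]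
    ring
  have hchar : ∀ (x : L) (hx0 : (φ x : V) ≠ 0),
      Projectivization.mk L (φ x : V) hx0 ∈ projectionPreimage Γ ℓ (pts L (Submodule.span K {u, v}))
        ↔ ∃ y z k : K, algebraMap K L y + algebraMap K L z * a ≠ 0 ∧ x = algebraMap K L k *
          (d * ∏ l ∈ Finset.range n, (σ ^ l) (algebraMap K L y + algebraMap K L z * a)) := by
    intro x hx0
    have hx : x ≠ 0 := by
      rintro rfl
      exact hx0 (by simp)
    rw [mk_mem_projectionPreimage_iff hd hc]
    constructor
    · rintro ⟨w, hw, hw0, -, l, hl, h⟩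
      obtain ⟨y, z, rfl⟩ := Submodule.mem_span_pair.1 hw
      rw [map_pair_eq hu hv, hφ, smul_smul, Prod.smul_mk, Prod.mk.injEq, hgz, smul_eq_mul,
        smul_eq_mul] at h
      set m := algebraMap K L y + algebraMap K L z * a with hm
      have hm0 : m ≠ 0 := by
        intro h0
        rw [h0, mul_zero] at h
        exact mul_ne_zero (mul_ne_zero hl hl₀) hx h.1.symm
      obtain ⟨k, hk⟩ := exists_eq_algebraMap_mul_of_quotient hσ (x := x) (n := n) hd0 hm0 (by
        apply mul_left_cancel₀ hp
        linear_combination (-((σ ^ n) m * x)) * hpd + d * x * h.2 - d * σ x * h.1)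
      exact ⟨y, z, k, hm0, hk⟩
    · rintro ⟨y, z, k, hm0, hxk⟩
      have hcw := map_pair_eq hu hv y z
      rw [hgz] at hcw
      set m := algebraMap K L y + algebraMap K L z * a with hm
      have hq := quotient_of_eq_algebraMap_mul (σ := σ) (d := d) (z := m) (n := n) k
      rw [← hxk] at hq
      have hmem : y • u + z • v ∈ Submodule.span K {u, v} := Submodule.mem_span_pair.2 ⟨y, z, rfl⟩
      refine ⟨y • u + z • v, hmem, ?_, hRℓ _ hmem, p * m / (l₀ * x),
        div_ne_zero (mul_ne_zero hp hm0) (mul_ne_zero hl₀ hx), ?_⟩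
      · intro h0
        rw [h0, map_zero] at hcw
        exact mul_ne_zero hp hm0 (congrArg Prod.fst hcw).symm
      · rw [hcw, hφ, smul_smul, Prod.smul_mk, Prod.mk.injEq, smul_eq_mul, smul_eq_mul]
        constructor
        · field_simp
        · field_simp
          apply mul_left_cancel₀ hd0
          linear_combination ((σ ^ n) m * x) * hpd + p * hq
  -- The frame: coefficients of the product as a polynomial in `y`. The leading one gives the point
  -- at infinity, `z = a`.
  let b' : Fin (n + 1) → V := fun j => φ (d * (conjProd σ a 0 n).coeff j)
  have hli : LinearIndependent K b' := by
    have h1 := (linearIndependent_coeff_conjProd σ a n ha).map' (LinearMap.mulLeft K d)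
      (LinearMap.ker_eq_bot.2 (mul_right_injective₀ hd0))
    have h2 := h1.map' (W.subtype ∘ₗ φ.toLinearMap) (LinearMap.ker_eq_bot.2
      (W.injective_subtype.comp φ.injective))
    exact h2
  have hb' : ∀ i, ((Module.Basis.span hli i : Submodule.span K (Set.range b')) : V) = b' i :=
    fun i => congrArg Subtype.val (Module.Basis.span_apply hli i)
  have hfin : ∀ y : K, ∑ i : Fin (n + 1), y ^ (i : ℕ) • b' i =
      φ (d * ∏ l ∈ Finset.range n, (σ ^ l) (1 + y • a)) := by
    intro y
    rw [prod_one_add_eq_sum, Finset.mul_sum, map_sum, Submodule.coe_sum]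
    refine Finset.sum_congr rfl fun i _ => ?_
    rw [mul_smul_comm, map_smul, Submodule.coe_smul]
  have hlast : b' (Fin.last n) = φ (d * ∏ l ∈ Finset.range n, (σ ^ l) a) := by
    simp only [b', Fin.val_last, coeff_conjProd_self]
  refine ⟨Submodule.span K (Set.range b'), ?_, Module.Basis.span hli, ?_⟩
  · rw [Submodule.span_le]
    rintro _ ⟨i, rfl⟩
    exact (φ _).2
  simp only [hb', hfin, hlast]
  have hprod0 : ∀ z : L, z ≠ 0 → d * ∏ l ∈ Finset.range n, (σ ^ l) z ≠ 0 := fun z hz =>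
    mul_ne_zero hd0 (Finset.prod_ne_zero_iff.2 fun l _ => (map_ne_zero _).2 hz)
  have hspan : ∀ (k : K) (x : L), k ≠ 0 → Submodule.span L {(φ (algebraMap K L k * x) : V)} =
      Submodule.span L {(φ x : V)} := by
    intro k x hk
    rw [← Algebra.smul_def, map_smul, Submodule.coe_smul, ← algebraMap_smul L,
      Submodule.span_singleton_smul_eq ((map_ne_zero (algebraMap K L)).2 hk).isUnit]
  have hpow : ∀ (k : K) (z : L), ∏ l ∈ Finset.range n, (σ ^ l) (algebraMap K L k * z) =
      algebraMap K L (k ^ n) * ∏ l ∈ Finset.range n, (σ ^ l) z := by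
    intro k z
    simp only [map_mul, AlgEquiv.commutes, Finset.prod_mul_distrib, Finset.prod_const,
      Finset.card_range, map_pow]
  have hback : ∀ (P : ℙ L V) (y z : K) , algebraMap K L y + algebraMap K L z * a ≠ 0 →
      P.submodule = Submodule.span L {(φ (d * ∏ l ∈ Finset.range n,
        (σ ^ l) (algebraMap K L y + algebraMap K L z * a)) : V)} →
      P ∈ pts L W ∩ projectionPreimage Γ ℓ (pts L (Submodule.span K {u, v})) := by
    intro P y z hyz hP
    have hne : (φ (d * ∏ l ∈ Finset.range n,
        (σ ^ l) (algebraMap K L y + algebraMap K L z * a)) : V) ≠ 0 := by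
      simpa only [ne_eq, ZeroMemClass.coe_eq_zero, LinearEquiv.map_eq_zero_iff] using hprod0 _ hyz
    have hPmk : P = Projectivization.mk L _ hne := by
      apply Projectivization.submodule_injective
      rw [hP, Projectivization.submodule_mk]
    rw [hPmk]
    exact ⟨⟨_, (φ _).2, hne, rfl⟩, (hchar _ hne).2 ⟨y, z, 1, hyz, by rw [map_one, one_mul]⟩⟩
  ext P
  constructor
  · rintro ⟨⟨w, hw, hw0, rfl⟩, hpre⟩
    obtain ⟨x, hx⟩ := φ.surjective ⟨w, hw⟩
    have hwx : w = φ x := by rw [hx]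
    subst hwx
    obtain ⟨y, z, k, hyz, hxk⟩ := (hchar x hw0).1 hpre
    have hk : k ≠ 0 := by
      rintro rfl
      rw [map_zero, zero_mul] at hxk
      exact hw0 (by simp [hxk])
    simp only [Set.mem_ofPred_eq, Projectivization.submodule_mk]
    rw [hxk, hspan k _ hk]
    by_cases hy : y = 0
    · right
      have hz : z ≠ 0 := by
        rintro rfl
        exact hyz (by simp [hy])
      rw [hy, map_zero, zero_add, hpow, mul_left_comm, hspan _ _ (pow_ne_zero n hz)]
    · left
      refine ⟨z / y, ?_⟩
      have h1 : algebraMap K L y + algebraMap K L z * a =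
          algebraMap K L y * (1 + (z / y) • a) := by
        have : algebraMap K L y ≠ 0 := (map_ne_zero _).2 hy
        rw [Algebra.smul_def, map_div₀]
        field_simp
      rw [h1, hpow, mul_left_comm, hspan _ _ (pow_ne_zero n hy)]
  · rintro (⟨y, hP⟩ | hP)
    · have h1 : 1 + y • a = algebraMap K L 1 + algebraMap K L y * a := by
        rw [map_one, Algebra.smul_def]
      rw [h1] at hP
      exact hback P 1 y (fun h0 => one_ne_zero (hz0 _ _ h0).1) hP
    · have h1 : a = algebraMap K L 0 + algebraMap K L 1 * a := by
        rw [map_one, map_zero, one_mul, zero_add]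
      refine hback P 0 1 (fun h0 => one_ne_zero (hz0 _ _ h0).2) ?_
      rw [← h1]
      exact hP

end Curve

/-! ### Comparing two adapted coordinate systems -/

section Transfer

variable {K L V : Type*} [Field K] [Finite K] [Field L] [Algebra K L] [FiniteDimensional K L]
  [AddCommGroup V] [Module L V] [Module K V]

theorem exists_matrix_of_ker_eq {c c' : V →ₗ[L] L × L} (hsurj : Function.Surjective c)
    (hker : LinearMap.ker c = LinearMap.ker c') : ∃ α β γ δ : L, ∀ v, c' v =
      (α * (c v).1 + β * (c v).2, γ * (c v).1 + δ * (c v).2) := by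
  obtain ⟨v₁, h₁⟩ := hsurj (1, 0)
  obtain ⟨v₂, h₂⟩ := hsurj (0, 1)
  refine ⟨(c' v₁).1, (c' v₂).1, (c' v₁).2, (c' v₂).2, fun v => ?_⟩
  have h : v - (c v).1 • v₁ - (c v).2 • v₂ ∈ LinearMap.ker c' := by
    rw [← hker, LinearMap.mem_ker, map_sub, map_sub, map_smul, map_smul, h₁, h₂]
    ext <;> simp
  rw [LinearMap.mem_ker, map_sub, map_sub, map_smul, map_smul, sub_sub, sub_eq_zero] at h
  rw [h]
  ext <;> simp [mul_comm]

/-- The data of a subline in two adapted coordinate systems. -/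
theorem IsTwistedPair.transfer (ht : 3 ≤ Module.finrank K L) {c c' : V →ₗ[L] L × L}
    (hsurj : Function.Surjective c) (hker : LinearMap.ker c = LinearMap.ker c')
    {s s' : L ≃ₐ[K] L} (hs : orderOf s = Module.finrank K L)
    (hs' : orderOf s' = Module.finrank K L) {W : Submodule K V} {φ φ' : L ≃ₗ[K] W} {l l' : L}
    (hl : l ≠ 0) (hl' : l' ≠ 0) (hφ : ∀ x, c (φ x) = l • (x, s x))
    (hφ' : ∀ x, c' (φ' x) = l' • (x, s' x)) {R : Submodule K V} {a : L} {g : L ≃ₐ[K] L} {n : ℕ}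
    (hT : IsTwistedPair c R a g) (hn : (s ^ n) a = g a) :
    ∃ a' g', IsTwistedPair c' R a' g' ∧ (s' ^ n) a' = g' a' ∧
      ∀ f f' : L ≃ₐ[K] L, f a' = f' a' → f a = f' a := by
  obtain ⟨α, β, γ, δ, hM⟩ := exists_matrix_of_ker_eq hsurj hker
  have hθ : ∀ x, ∃ y, (x ≠ 0 → y ≠ 0) ∧ l * (α * x + β * s x) = l' * y ∧
      l * (γ * x + δ * s x) = l' * s' y := by
    intro x
    have h1 := hφ' (φ'.symm (φ x))
    rw [LinearEquiv.apply_symm_apply, hM, hφ, Prod.smul_mk, Prod.smul_mk, Prod.mk.injEq] at h1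
    simp only [smul_eq_mul] at h1
    refine ⟨φ'.symm (φ x), fun hx => by simpa using hx, ?_, ?_⟩
    · linear_combination h1.1
    · linear_combination h1.2
  -- Both systems describe the same vector; eliminating its second label `y` leaves a relation among
  -- `1`, `s`, `s'`, `s' * s`.
  have hrel : ∀ x, l * γ * x + l * δ * s x =
      l' * s' (l / l' * α) * s' x + l' * s' (l / l' * β) * s' (s x) := by
    intro x
    obtain ⟨y, -, h1, h2⟩ := hθ x
    have h3 : y = l / l' * α * x + l / l' * β * s x := by
      field_simp
      linear_combination -h1
    rw [h3] at h2
    simp only [map_add, map_mul] at h2 ⊢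
    linear_combination h2
  obtain ⟨y, hy0, hy1, hy2⟩ := hθ 1
  replace hy0 := hy0 one_ne_zero
  rw [map_one, mul_one, mul_one] at hy1 hy2
  have hzero : ∀ z : L, l' * s' (l / l' * z) = 0 → z = 0 := by
    intro z hz
    simpa [hl, hl'] using hz
  obtain ⟨u, v, p, p', rfl, hp, hp', hu, hv⟩ := hT
  have hAB : l' * s' (l / l' * α) ≠ 0 ∨ l' * s' (l / l' * β) ≠ 0 := by
    by_contra! h0
    rw [hzero _ h0.1, hzero _ h0.2, add_zero, mul_zero] at hy1
    exact mul_ne_zero hl' hy0 hy1.symm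
  rcases generators_of_relation ht hs hs' hAB hrel with ⟨rfl, hγ, hβ⟩ | ⟨hss, hα, hδ⟩
  · replace hγ : γ = 0 := (mul_eq_zero.1 hγ).resolve_left hl
    replace hβ := hzero _ hβ
    subst hγ hβ
    have hα0 : α ≠ 0 := by
      rintro rfl
      rw [add_zero, mul_zero] at hy1
      exact mul_ne_zero hl' hy0 hy1.symm
    have hδ0 : δ ≠ 0 := by
      rintro rfl
      rw [add_zero, mul_zero] at hy2
      exact mul_ne_zero hl' ((map_ne_zero s').2 hy0) hy2.symm
    refine ⟨a, g, ⟨u, v, α * p, δ * p', rfl, mul_ne_zero hα0 hp, mul_ne_zero hδ0 hp', ?_, ?_⟩, hn,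
      fun f f' h => h⟩
    · rw [hM, hu]
      simp
    · rw [hM, hv]
      simp [mul_assoc]
  · replace hδ : δ = 0 := (mul_eq_zero.1 hδ).resolve_left hl
    replace hα := hzero _ hα
    subst hδ hα
    have hβ0 : β ≠ 0 := by
      rintro rfl
      rw [add_zero, mul_zero] at hy1
      exact mul_ne_zero hl' hy0 hy1.symm
    have hγ0 : γ ≠ 0 := by
      rintro rfl
      rw [add_zero, mul_zero] at hy2
      exact mul_ne_zero hl' ((map_ne_zero s').2 hy0) hy2.symm
    -- In the antidiagonal case the coordinates swap, so `a` becomes `g a` and `g` its inverse; `n`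
    -- survives because `s'` is inverse to `s`.
    refine ⟨g a, g⁻¹, ⟨u, v, β * p', γ * p, rfl, mul_ne_zero hβ0 hp', mul_ne_zero hγ0 hp, ?_, ?_⟩,
      ?_, fun f f' h => ?_⟩
    · rw [hM, hu]
      simp
    · rw [hM, hv]
      simp [mul_assoc, ← AlgEquiv.mul_apply]
    · rw [← hn, ← AlgEquiv.mul_apply, ← (show Commute s' s from algEquiv_mul_comm _ _).mul_pow,
        hss, one_pow, hn, ← AlgEquiv.mul_apply, inv_mul_cancel]
    · rw [algEquiv_apply_comm, algEquiv_apply_comm f' g] at h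
      exact g.injective h

end Transfer

end PseudoregulusType

/-! ### The main theorem -/

open PseudoregulusType
theorem theorem5 {K L V : Type*} [Field K] [Finite K] [Field L] [Algebra K L]
    [AddCommGroup V] [Module L V] [Module K V] [IsScalarTower K L V]
    (t : ℕ) (ht : 2 ≤ t) (hqt : t ≤ Nat.card K)
    (hL : Module.finrank K L = t) (hV : Module.finrank L V = t)
    (W : Submodule K V) (hW : IsCanonicalSubgeometry (⊤ : Submodule L V) W)
    (Γ ℓ₀ : Submodule L V)
    (hΓ : Module.finrank L Γ + 2 = t) (hℓ₀ : Module.finrank L ℓ₀ = 2)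
    (hΓℓ₀ : Disjoint Γ ℓ₀) (hWΓ : ∀ P ∈ pts L W, ¬ P.submodule ≤ Γ)
    (hpseudo : IsPseudoregulusType K ℓ₀ (projection Γ ℓ₀ (pts L W)))
    (R : Submodule K V) (hR : IsCanonicalSubgeometry ℓ₀ R)
    (hRsub : pts L R ⊆ projection Γ ℓ₀ (pts L W)) :
    ∃ m n : ℕ, m ∣ t ∧ 1 < m ∧ 1 ≤ n ∧ n ≤ m - 1 ∧
      IsNormalRationalCurve W n (pts L W ∩ projectionPreimage Γ ℓ₀ (pts L R)) ∧
      (∃ (ν : ℕ) (e : V ≃ₗ[L] (Fin t → L)), IsAdapted W Γ ht ν e) ∧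
      ∀ (ν : ℕ) (e : V ≃ₗ[L] (Fin t → L)), IsAdapted W Γ ht ν e →
        (∃ h : ℕ, 1 ≤ h ∧ h ≤ t - 1 ∧
          HasTransversalInFamily K (lastTwo ht e) (pts L R) h) ∧
        ∀ h : ℕ, h ≤ t - 1 → HasTransversalInFamily K (lastTwo ht e) (pts L R) h →
          (n : ZMod m) = (h : ZMod m) * (ν : ZMod m)⁻¹ := by
  have : FiniteDimensional K L := FiniteDimensional.of_finrank_pos (by omega)
  have hR2 : Module.finrank K R = 2 := hR.1.trans hℓ₀
  have hRℓ : ∀ u ∈ R, u ∈ ℓ₀ := fun u hu => hR.2 ▸ Submodule.subset_span hu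
  have hWΓ' : ∀ w ∈ W, w ≠ 0 → w ∉ Γ := by
    intro w hw hw0 hmem
    apply hWΓ _ ⟨w, hw, hw0, rfl⟩
    rwa [Projectivization.submodule_mk, Submodule.span_singleton_le_iff_mem]
  have hinj : ∀ (ν : ℕ) (e : V ≃ₗ[L] (Fin t → L)), IsAdapted W Γ ht ν e →
      ∀ v ∈ ℓ₀, lastTwo ht e v = 0 → v = 0 := fun ν e he v hv h0 =>
    Submodule.disjoint_def.1 hΓℓ₀ v (he.center ▸ LinearMap.mem_ker.2 h0) hv
  have hnorm : ∀ (ν : ℕ) (e : V ≃ₗ[L] (Fin t → L)), IsAdapted W Γ ht ν e →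
      ∀ u ∈ R, u ≠ 0 → Algebra.norm K (lastTwo ht e u).1 = Algebra.norm K (lastTwo ht e u).2 ∧
        (lastTwo ht e u).1 ≠ 0 ∧ (lastTwo ht e u).2 ≠ 0 := by
    intro ν e he u hu hu0
    obtain ⟨l, φ, hl, hφ⟩ := he.exists_parametrization hL hV hW
    obtain ⟨-, w, hw, hw0, l', hl', h⟩ := (mk_mem_projection_iff hΓℓ₀ he.center.symm hu0).1
      (hRsub ⟨u, hu, hu0, rfl⟩)
    obtain ⟨x, hx⟩ := φ.surjective ⟨w, hw⟩
    have hwx : w = φ x := by rw [hx]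
    subst hwx
    have hx0 : x ≠ 0 := by
      rintro rfl
      exact hw0 (by simp)
    rw [h, hφ, smul_smul]
    simp only [Prod.smul_mk, smul_eq_mul, map_mul]
    exact ⟨by rw [norm_relFrobenius_pow], mul_ne_zero (mul_ne_zero hl' hl) hx0,
      mul_ne_zero (mul_ne_zero hl' hl) ((map_ne_zero _).2 hx0)⟩
  have htwisted : ∀ (ν : ℕ) (e : V ≃ₗ[L] (Fin t → L)), IsAdapted W Γ ht ν e →
      ∃ (a : L) (g : L ≃ₐ[K] L), IsTwistedPair (lastTwo ht e) R a g ∧ g a ≠ a := fun ν e he =>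
    exists_isTwistedPair (hL ▸ hqt) hℓ₀ hR (hinj ν e he) (hnorm ν e he)
  have hdim : Module.finrank L Γ + Module.finrank L ℓ₀ = Module.finrank L V := by
    rw [hℓ₀, hΓ, hV]
  obtain ⟨ν, e, he⟩ := exists_adapted ht hqt hL hV hW hΓℓ₀ hdim hWΓ' hpseudo
  obtain ⟨l, φ, hl, hφ⟩ := he.exists_parametrization hL hV hW
  obtain ⟨a, g, hT, hga⟩ := htwisted ν e he
  have hord := orderOf_relFrobenius K L
  set τ := relFrobenius K L with hτ
  -- Powers of `τ` act on `a` through their exponents modulo this period, and `ν` is invertible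
  -- there because `m ∣ t`.
  set m := MulAction.period τ a with hm
  have hmt : m ∣ t := by
    rw [← hL, ← hord]
    exact MulAction.period_dvd_orderOf τ a
  have hm0 : m ≠ 0 := by
    rintro h0
    rw [h0, zero_dvd_iff] at hmt
    omega
  have : NeZero m := ⟨hm0⟩
  have hunit : ∀ k : ℕ, Nat.Coprime k t → (k : ZMod m) * (k : ZMod m)⁻¹ = 1 := fun k hk =>
    ZMod.coe_mul_inv_eq_one k (hk.coprime_dvd_right hmt)
  have hiff : ∀ i j : ℕ, (τ ^ i) a = (τ ^ j) a ↔ (i : ZMod m) = j :=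
    pow_apply_eq_pow_apply_iff τ a
  obtain ⟨h₀, hh₀, rfl⟩ := exists_relFrobenius_pow_eq g
  set n := ((h₀ : ZMod m) * (ν : ZMod m)⁻¹).val with hn
  have hnval : (n : ZMod m) = (h₀ : ZMod m) * (ν : ZMod m)⁻¹ := ZMod.natCast_zmod_val _
  have hnm : n < m := ZMod.val_lt _
  have hσn : ((τ ^ ν) ^ n) a = (τ ^ h₀) a := by
    rw [← pow_mul, hiff, Nat.cast_mul, hnval, mul_left_comm, hunit ν he.coprime, mul_one]
  -- If `n` were `0`, then `g` would fix `a`. With `n < m` this also yields `1 < m`.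
  have hn0 : n ≠ 0 := by
    intro h0
    rw [h0, pow_zero] at hσn
    exact hga hσn.symm
  have hfree : ∀ k, 0 < k → k ≤ n → ((τ ^ ν) ^ k) a ≠ a := by
    intro k hk hkn hka
    have h1 : (τ ^ (ν * k)) a = (τ ^ 0) a := by rw [pow_mul, hka, pow_zero, AlgEquiv.one_apply]
    rw [hiff, Nat.cast_mul, Nat.cast_zero] at h1
    have h2 : (k : ZMod m) = 0 := by
      rw [← one_mul (k : ZMod m), ← hunit ν he.coprime, mul_right_comm, h1, zero_mul]
    rw [ZMod.natCast_eq_zero_iff] at h2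
    have := Nat.le_of_dvd hk h2
    omega
  refine ⟨m, n, hmt, by omega, by omega, by omega, ?_, ⟨ν, e, he⟩, ?_⟩
  · exact isNormalRationalCurve_inter_projectionPreimage hΓℓ₀ he.center.symm
      (by rw [orderOf_relFrobenius_pow hL he.coprime, hL]) φ hl hφ hRℓ hRsub hT (by omega) hσn hfree
  intro ν' e' he'
  obtain ⟨l', φ', hl', hφ'⟩ := he'.exists_parametrization hL hV hW
  obtain ⟨a', g', hT', hga'⟩ := htwisted ν' e' he'
  constructor
  · obtain ⟨h, hht, rfl⟩ := exists_relFrobenius_pow_eq g'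
    refine ⟨h, ?_, by omega, hT'.hasTransversalInFamily hR2
      (fun v hv => hinj ν' e' he' v (hRℓ v hv)) fun u hu hu0 => (hnorm ν' e' he' u hu hu0).1⟩
    rw [Nat.one_le_iff_ne_zero]
    rintro rfl
    exact hga' rfl
  intro h hht hF
  obtain ⟨b, hb⟩ := IsTwistedPair.of_hasTransversalInFamily hga' hT' hF
  suffices hmul : (h : ZMod m) = (ν' : ZMod m) * n by
    rw [hmul, mul_right_comm, hunit ν' he'.coprime, one_mul]
  -- For `t = 2` the matrix comparison is unavailable, but `m = 2` and `n = h = 1` are forced, and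
  -- `ν'` is odd.
  rcases Nat.lt_or_ge t 3 with ht3 | ht3
  · obtain rfl : t = 2 := by omega
    have hm2 : m = 2 := by
      have := Nat.le_of_dvd two_pos hmt
      omega
    have hn1 : n = 1 := by omega
    have hh1 : h = 1 := by
      by_contra hne
      obtain rfl : h = 0 := by omega
      apply hga'
      obtain ⟨h1, -⟩ := hT'.apply_eq hb
      obtain ⟨-, h2⟩ := hb.apply_eq hT'
      exact h2 g' 1 h1.symm
    have hν1 : (ν' : ZMod m) = 1 := by
      have hodd := he'.coprime.odd_of_right
      have h3 : ((ν' : ℕ) : ZMod m) = ((1 : ℕ) : ZMod m) := by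
        rw [ZMod.natCast_eq_natCast_iff', hm2]
        exact Nat.odd_iff.1 hodd
      simpa using h3
    rw [hh1, hn1, hν1, Nat.cast_one, mul_one]
  · have hsurj : Function.Surjective (lastTwo ht e) := by
      rintro ⟨x, y⟩
      refine ⟨e.symm (Function.update (fun _ => x) ⟨t - 1, by omega⟩ y), ?_⟩
      rw [lastTwo_apply, LinearEquiv.apply_symm_apply, Function.update_self,
        Function.update_of_ne]
      simp only [ne_eq, Fin.mk.injEq]
      omega
    obtain ⟨a₁, g₁, hT₁, hn₁, hback⟩ := hT.transfer (by omega) hsurj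
      (he.center.symm.trans he'.center) (by rw [orderOf_relFrobenius_pow hL he.coprime, hL])
      (by rw [orderOf_relFrobenius_pow hL he'.coprime, hL]) hl hl' hφ hφ' hσn
    obtain ⟨h1, h2⟩ := hT₁.apply_eq hb
    obtain ⟨-, h3⟩ := hb.apply_eq hT₁
    -- The exponents `h` and `ν' * n` agree on `b`, then on `a₁`, then on `a`, whose period is `m`.
    have h4 : (τ ^ h) b = (τ ^ (ν' * n)) b := by
      rw [h1, ← h2 _ _ hn₁, pow_mul]
    have h5 := hback _ _ (h3 _ _ h4)
    rw [hiff] at h5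
    rw [h5, Nat.cast_mul]
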